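/- Let $n\ge 1$ be an integer, let $a_k>0$, $d_k$, $\beta_k$ ($k=1,\dots,n$) be real numbers with $\sum_{k=1}^n a_k=1$ and $\sum_{k=1}^n a_k|d_k|^2<1$, and put $\alpha_0=0$, $\alpha_k=\alpha_{k-1}+a_k$. Let $P\in L_2[0,1]$ be the (real-valued) self-similar function with these parameters, i.e. for each $k=1,\dots,n$ $$P(x)=\beta_k+d_k\,P\!\left(\frac{x-\alpha_{k-1}}{a_k}\right)\qquad\text{for almost all }x\in(\alpha_{k-1},\alpha_k).$$ Suppose that $P$ has spectral order zero, in the sense that for some $m\in\{1,\dots,n\}$ one has $d_k=0$ for all $k\ne m$. For $k=1,\dots,n-1$ put $$\zeta_k=\begin{cases}\beta_m-\beta_{m-1}+d_m\beta_1,&k=m-1,\\ \beta_{m+1}-\beta_m-d_m\beta_n,&k=m,\\ \beta_{k+1}-\beta_k,&\text{otherwise},\end{cases}\qquad Z_\pm=\#\{k\in\{1,\dots,n-1\}:\ \pm\zeta_k>0\}.$$ Let $\rho=P'$ (generalized derivative), and consider the boundary value problem $$-y''-\lambda\rho y=0,\qquad y(0)=y(1)=0.$$ A real number $\lambda$ is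 an eigenvalue of it if there is a nonzero complex-valued $y\in \mathring W_2^1[0,1]$ such that $\int_0^1\bigl(y'\overline{z'}+\lambda P\cdot(y\overline z)'\bigr)\,dx=0$ for all $z\in\mathring W_2^1[0,1]$. Assume $d_m>0$, $Z_+>0$ and $Z_++Z_-=n-1$. Then the positive eigenvalues are all simple (the solutions $y$ for such a $\lambda$ form a one-dimensional space) and form an infinite sequence $\lambda_1<\lambda_2<\cdots$, and there are real numbers $\mu_l>0$, $l=1,\dots,Z_+$, such that for every $l=1,\dots,Z_+$ $$\lambda_{l+kZ_+}=\mu_l\cdot(a_md_m)^{-k}\cdot(1+o(1))\qquad\text{as }k\to\infty.$$ -/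

import Mathlib

open Filter Topology MeasureTheory Asymptotics
open scoped ComplexConjugate

namespace SelfSimilarString

/-- The points `α_0 = 0`, `α_k = α_{k-1} + a_k` that cut `[0,1]` into pieces of lengths
`a_1, …, a_n`. -/
def cutPoint (a : ℕ → ℝ) (k : ℕ) : ℝ := ∑ j ∈ Finset.Icc 1 k, a j

/-- The similarity operator: on the `k`-th interval `(α_{k-1}, α_k)`, `k = 1, …, n`, the function
`G f` equals `β_k + d_k f((x - α_{k-1}) / a_k)`. -/
noncomputable def similarityOp (n : ℕ) (a d β : ℕ → ℝ) (f : ℝ → ℝ) (x : ℝ) : ℝ :=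
  ∑ k ∈ Finset.Icc 1 n,
    (Set.Ioo (cutPoint a (k - 1)) (cutPoint a k)).indicator
      (fun t => β k + d k * f ((t - cutPoint a (k - 1)) / a k)) x

/-- Admissible self-similarity parameters in `L₂[0,1]`: `a_k > 0`, `∑ a_k = 1` and
`∑ a_k |d_k|² < 1` (the similarity operator is then a contraction of `L₂[0,1]`). -/
structure AdmissibleParams (n : ℕ) (a d : ℕ → ℝ) : Prop where
  pos : ∀ k ∈ Finset.Icc 1 n, 0 < a k
  sum_eq_one : ∑ k ∈ Finset.Icc 1 n, a k = 1
  sum_lt_one : ∑ k ∈ Finset.Icc 1 n, a k * |d k| ^ 2 < 1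

/-- `P ∈ L₂[0,1]` is self-similar with the given parameters: `G P = P` in `L₂[0,1]`. -/
structure IsSelfSimilar (n : ℕ) (a d β : ℕ → ℝ) (P : ℝ → ℝ) : Prop where
  memLp : MemLp P 2 (volume.restrict (Set.Icc (0 : ℝ) 1))
  fixed : similarityOp n a d β P =ᵐ[volume.restrict (Set.Icc (0 : ℝ) 1)] P

/-- The numbers `ζ_k`, `k = 1, …, n - 1`:
`ζ_{m-1} = β_m - β_{m-1} + d_m β_1`, `ζ_m = β_{m+1} - β_m - d_m β_n`, and
`ζ_k = β_{k+1} - β_k` for the other `k`. -/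
noncomputable def zeta (n m : ℕ) (d β : ℕ → ℝ) (k : ℕ) : ℝ :=
  if k + 1 = m then β m - β k + d m * β 1
  else if k = m then β (m + 1) - β m - d m * β n
  else β (k + 1) - β k

/-- `Z₊ = #{k ∈ [1, n - 1] | ζ_k > 0}`. -/
noncomputable def Zplus (n m : ℕ) (d β : ℕ → ℝ) : ℕ :=
  ((Finset.Icc 1 (n - 1)).filter (fun k => 0 < zeta n m d β k)).card

/-- `Z₋ = #{k ∈ [1, n - 1] | -ζ_k > 0}`. -/
noncomputable def Zminus (n m : ℕ) (d β : ℕ → ℝ) : ℕ :=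
  ((Finset.Icc 1 (n - 1)).filter (fun k => 0 < -zeta n m d β k)).card

/-- Membership in the Sobolev space `W̊₂¹[0,1]` of complex-valued functions: `y` is absolutely
continuous on `[0,1]`, its derivative (which exists almost everywhere) is in `L₂[0,1]`, and
`y(0) = y(1) = 0`. Functions are extended by zero outside `[0,1]`, so that two elements are equal
as functions on `ℝ` exactly when they are equal on `[0,1]`. -/
structure MemH (y : ℝ → ℂ) : Prop where
  ac : AbsolutelyContinuousOnInterval y 0 1
  deriv_memLp : MemLp (deriv y) 2 (volume.restrict (Set.Icc (0 : ℝ) 1))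
  zero_off : ∀ x, x ∉ Set.Ioo (0 : ℝ) 1 → y x = 0

/-- The sesquilinear form of the pencil `T_ρ(λ)`, `ρ = P'`:
`∫₀¹ (y' z̄' + λ P (y z̄)') dx`. As `⟨P', φ⟩ = -∫ P φ'`, it is the pairing of
`-y'' - λ ρ y` with `z`. -/
noncomputable def pencilForm (P : ℝ → ℝ) (lam : ℝ) (y z : ℝ → ℂ) : ℂ :=
  ∫ x in (0 : ℝ)..1,
    (deriv y x * conj (deriv z x) +
      (lam : ℂ) * (P x : ℂ) * deriv (fun t => y t * conj (z t)) x)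

/-- `y` is in the kernel of `T_ρ(λ)`, `ρ = P'`, i.e. it is a solution in `W̊₂¹[0,1]` of
`-y'' - λ ρ y = 0`, `y(0) = y(1) = 0`. -/
def IsSolution (P : ℝ → ℝ) (lam : ℝ) (y : ℝ → ℂ) : Prop :=
  MemH y ∧ ∀ z : ℝ → ℂ, MemH z → pencilForm P lam y z = 0

/-- `λ` is an eigenvalue of the boundary problem. -/
def IsEigenvalue (P : ℝ → ℝ) (lam : ℝ) : Prop :=
  ∃ y : ℝ → ℂ, IsSolution P lam y ∧ y ≠ 0

/-- All solutions of the boundary problem for this `λ` are proportional to one of them. -/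
def IsSimpleEigenvalue (P : ℝ → ℝ) (lam : ℝ) : Prop :=
  ∃ y : ℝ → ℂ, (IsSolution P lam y ∧ y ≠ 0) ∧
    ∀ z : ℝ → ℂ, IsSolution P lam z → ∃ c : ℂ, z = c • y

end SelfSimilarString

/-!
Represent `y ∈ W̊₂¹[0,1]` by its derivative; the space becomes the Hilbert space of functions in
`L₂[0,1]` with integral zero, and the boundary problem becomes `g = λ K g` with a compact symmetric
operator `K` whose quadratic form is `b(y) = ⟨P', |y|²⟩`. So the positive eigenvalues are governed
by the sign of the forms `‖y'‖² - λ b(y)`: their number below `λ` is the largest dimension of a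
subspace on which this form is negative, and the smallest codimension of one on which it is
nonnegative.

The function `P` is constant on each piece of `[0,1]` except the `m`-th, where it is an affine image
of itself. Hence (`pairing_eq_mul_pairing_rescale`, `pairing_eq_jump`, assembled in
`exists_similarityDecomposition`) the space splits into functions that vanish at the cut points and
narrow tents around the `n - 1` interior cut points. On the former, `b` is `d_m` times itself after
rescaling of the `m`-th piece, on the latter it is diagonal with the entries `ζ_k`, and the two parts
are orthogonal for `b`. The Dirichlet form scales by `1 / a_m`; its mixed terms between the
two parts are absorbed, by a weighted Young inequality, into the terms `λ ζ_k |y(α_k)|²`, which are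
all nondegenerate, at the price of a shift of `λ` by a constant `C`
(`SimilarityDecomposition.form_neg`, `SimilarityDecomposition.form_nonneg`). Comparing dimensions,
and with `q = a_m d_m ∈ (0, 1)`, the number of eigenvalues below `(λ + C) / q` is at least, and
below `(λ - C) / q` at most, `Z₊` plus the number of eigenvalues up to `λ`.

For the enumeration `λ_1 < λ_2 < ⋯` this says `|q λ_{j+Z₊} - λ_j| ≤ 2C`. Therefore
`q^k λ_{l+kZ₊}` is a Cauchy sequence in `k`; its limit is positive, since the same estimate bounds it
below once `λ_l` has become large, and this is the asserted asymptotics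
(`exists_enumeration_isEquivalent`).

Simplicity comes from the first-order form of the equation: a solution satisfies
`y' = κ + λ (∫₀ˣ P y' - P y)` with a constant `κ` (`exists_quasiderivative_eq`), and `κ = 0` forces
`y = 0` (`eq_zero_of_quasiderivative_eq_zero`), so a solution is determined by the number `κ`.
-/

namespace SelfSimilarString

/-! ### Enumeration and asymptotics of a locally finite set of numbers -/

/-- An infinite set of reals with finitely many elements below each bound is the range of a
strictly increasing sequence. -/
theorem exists_strictMono_range_eq {S : Set ℝ} (hfin : ∀ R, (S ∩ Set.Iio R).Finite)
    (hinf : S.Infinite) : ∃ e : ℕ → ℝ, StrictMono e ∧ Set.range e = S := by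
  classical
  have hne : S.Nonempty := hinf.nonempty
  obtain ⟨x₀, hx₀⟩ := hne
  have hmin : ∃ b ∈ S, ∀ x ∈ S, b ≤ x := by
    obtain ⟨b, hb, hb'⟩ := Set.exists_min_image (S ∩ Set.Iio (x₀ + 1)) id (hfin _)
      ⟨x₀, hx₀, by simp⟩
    refine ⟨b, hb.1, fun x hx => ?_⟩
    by_cases h : x < x₀ + 1
    · exact hb' x ⟨hx, h⟩
    · have := hb.2
      simp only [Set.mem_Iio] at this
      linarith
  obtain ⟨b, hbS, hb⟩ := hmin
  have : Nonempty S := ⟨⟨b, hbS⟩⟩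
  let _ : LocallyFiniteOrder S := LocallyFiniteOrder.ofFiniteIcc (fun x y => by
    refine Set.Finite.of_finite_image (f := Subtype.val) ((hfin (y.1 + 1)).subset ?_)
      Subtype.val_injective.injOn
    rintro _ ⟨z, hz, rfl⟩
    have : z.1 ≤ y.1 := hz.2
    exact ⟨z.2, by simp only [Set.mem_Iio]; linarith⟩)
  let _ : SuccOrder S := LinearLocallyFiniteOrder.succOrder S
  let _ : PredOrder S := LinearLocallyFiniteOrder.predOrder S
  let _ : OrderBot S := { bot := ⟨b, hbS⟩, bot_le := fun x => hb x.1 x.2 }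
  have : NoMaxOrder S := ⟨fun x => by
    by_contra! h
    refine hinf ((hfin (x.1 + 1)).subset fun z hz => ⟨hz, ?_⟩)
    have : z ≤ x.1 := h ⟨z, hz⟩
    simp only [Set.mem_Iio]; linarith⟩
  let i : S ≃o ℕ := orderIsoNatOfLinearSuccPredArch
  refine ⟨fun k => (i.symm k).1, fun k l hkl => ?_, ?_⟩
  · exact i.symm.strictMono hkl
  · ext x
    constructor
    · rintro ⟨k, rfl⟩
      exact (i.symm k).2
    · intro hx
      exact ⟨i ⟨x, hx⟩, by simp⟩

theorem ncard_range_inter_Iio {e : ℕ → ℝ} (he : StrictMono e) (j : ℕ) :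
    (Set.range e ∩ Set.Iio (e j)).ncard = j := by
  have : Set.range e ∩ Set.Iio (e j) = e '' (Finset.range j : Set ℕ) := by
    ext x
    constructor
    · rintro ⟨⟨k, rfl⟩, hk⟩
      exact ⟨k, by simpa using he.lt_iff_lt.1 hk, rfl⟩
    · rintro ⟨k, hk, rfl⟩
      exact ⟨⟨k, rfl⟩, he (by simpa using hk)⟩
  rw [this, Set.ncard_image_of_injective _ he.injective, Set.ncard_coe_finset, Finset.card_range]

/-- A sequence with `|q e_{k+1} - e_k| ≤ D`, `0 < q < 1`, that tends to infinity is asymptotically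
geometric: the increments of `q ^ k e_k` are bounded by `D q ^ k`, and the tail of this geometric
series is negligible against `q ^ k e_k`, so that the limit is positive. -/
theorem exists_tendsto_geometric {q D : ℝ} (hq0 : 0 < q) (hq1 : q < 1) {c : ℕ → ℝ}
    (hc : ∀ k, |q * c (k + 1) - c k| ≤ D) (hinf : Tendsto c atTop atTop) :
    ∃ μ, 0 < μ ∧ Tendsto (fun k => q ^ k * c k) atTop (𝓝 μ) := by
  have hdist : ∀ k, dist (q ^ k * c k) (q ^ (k + 1) * c (k + 1)) ≤ D * q ^ k := by
    intro k
    rw [dist_comm, Real.dist_eq]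
    have : q ^ (k + 1) * c (k + 1) - q ^ k * c k = q ^ k * (q * c (k + 1) - c k) := by ring
    rw [this, abs_mul, abs_of_pos (pow_pos hq0 k), mul_comm]
    exact mul_le_mul_of_nonneg_right (hc k) (pow_pos hq0 k).le
  obtain ⟨μ, hμ⟩ := cauchySeq_tendsto_of_complete (cauchySeq_of_le_geometric q D hq1 hdist)
  refine ⟨μ, ?_, hμ⟩
  obtain ⟨k, hk⟩ := (hinf.eventually_gt_atTop (D / (1 - q))).exists
  have h := dist_le_of_le_geometric_of_tendsto q D hq1 hdist hμ k
  rw [Real.dist_eq] at h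
  have h2 := (abs_le.1 h).2
  have h3 : D * q ^ k / (1 - q) < q ^ k * c k := by
    have := mul_lt_mul_of_pos_left hk (pow_pos hq0 k)
    calc D * q ^ k / (1 - q) = q ^ k * (D / (1 - q)) := by ring
      _ < _ := this
  linarith

/-- A set of positive numbers whose counting function satisfies
`N((λ - C) / q) ≤ N(λ) + Z` and `N(λ+) + Z ≤ N((λ + C) / q)` splits, after enumeration, into `Z`
asymptotically geometric progressions with ratio `q⁻¹`. -/
theorem exists_enumeration_isEquivalent {S : Set ℝ}
    (hfin : ∀ R, (S ∩ Set.Iio R).Finite) {Z : ℕ} (hZ : 0 < Z) {q C : ℝ} (hq0 : 0 < q) (hq1 : q < 1)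
    (hC : 0 ≤ C) (hpos : ∀ x ∈ S, 0 < x)
    (low : ∀ (s : Finset ℝ) (r : ℝ), ↑s ⊆ S → 0 ≤ r → (∀ x ∈ s, x ≤ r) →
      s.card + Z ≤ (S ∩ Set.Iio ((r + C) / q)).ncard)
    (up : ∀ r, 2 * C < r → (S ∩ Set.Iio ((r - C) / q)).ncard ≤ (S ∩ Set.Iio r).ncard + Z) :
    ∃ lam : ℕ → ℝ, StrictMonoOn lam (Set.Ici 1) ∧ lam '' Set.Ici 1 = S ∧
      ∃ μ : ℕ → ℝ, ∀ l ∈ Finset.Icc 1 Z, 0 < μ l ∧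
        (fun k : ℕ => lam (l + k * Z)) ~[atTop] (fun k : ℕ => μ l * q ^ (-(k : ℤ))) := by
  have hinf : S.Infinite := by
    intro hS
    have hb : ∃ r, 0 ≤ r ∧ ∀ x ∈ hS.toFinset, x ≤ r := by
      obtain ⟨r, hr⟩ := hS.bddAbove
      exact ⟨max r 0, le_max_right _ _,
        fun x hx => (hr (hS.mem_toFinset.1 hx)).trans (le_max_left _ _)⟩
    obtain ⟨r, hr0, hr⟩ := hb
    have h1 := low hS.toFinset r (by simp) hr0 hr
    have h2 : (S ∩ Set.Iio ((r + C) / q)).ncard ≤ S.ncard :=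
      Set.ncard_le_ncard Set.inter_subset_left hS
    rw [← Set.ncard_eq_toFinset_card S hS] at h1
    omega
  obtain ⟨e, he, rfl⟩ := exists_strictMono_range_eq hfin hinf
  have hepos : ∀ j, 0 < e j := fun j => hpos _ ⟨j, rfl⟩
  have hup : ∀ j, q * e (j + Z) ≤ e j + C := by
    intro j
    have h := low ((Finset.range (j + 1)).map ⟨e, he.injective⟩) (e j) (by
      intro x hx
      simp only [Finset.coe_map, Function.Embedding.coeFn_mk, Set.mem_image] at hx
      obtain ⟨k, -, rfl⟩ := hx
      exact ⟨k, rfl⟩) (hepos j).le (by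
      intro x hx
      simp only [Finset.mem_map, Finset.mem_range, Function.Embedding.coeFn_mk] at hx
      obtain ⟨k, hk, rfl⟩ := hx
      exact he.monotone (by omega))
    rw [Finset.card_map, Finset.card_range] at h
    by_contra! hlt
    have hle : (e j + C) / q ≤ e (j + Z) := by
      rw [div_le_iff₀ hq0]; linarith
    have h2 : (Set.range e ∩ Set.Iio ((e j + C) / q)).ncard ≤
        (Set.range e ∩ Set.Iio (e (j + Z))).ncard :=
      Set.ncard_le_ncard (Set.inter_subset_inter_right _ (Set.Iio_subset_Iio hle)) (hfin _)
    rw [ncard_range_inter_Iio he] at h2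
    omega
  have hlow : ∀ j, e j - 2 * C ≤ q * e (j + Z) := by
    intro j
    by_cases hj : 2 * C < e j
    · have h := up (e j) hj
      rw [ncard_range_inter_Iio he] at h
      by_contra! hlt
      have hlt' : e (j + Z) < (e j - C) / q := by
        rw [lt_div_iff₀ hq0]; linarith
      have h2 : (Set.range e ∩ Set.Iio (e (j + Z + 1))).ncard ≤
          (Set.range e ∩ Set.Iio ((e j - C) / q)).ncard := by
        refine Set.ncard_le_ncard ?_ (hfin _)
        rintro _ ⟨⟨k, rfl⟩, hk⟩
        have : k ≤ j + Z := Nat.lt_succ_iff.1 (he.lt_iff_lt.1 hk)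
        exact ⟨⟨k, rfl⟩, (he.monotone this).trans_lt hlt'⟩
      rw [ncard_range_inter_Iio he] at h2
      omega
    · have := mul_pos hq0 (hepos (j + Z))
      linarith
  have htop : Tendsto e atTop atTop := by
    refine tendsto_atTop_atTop_of_monotone he.monotone fun R => ?_
    by_contra! h
    refine hinf ((hfin R).subset ?_)
    rintro _ ⟨k, rfl⟩
    exact ⟨⟨k, rfl⟩, h k⟩
  have hprog : ∀ l, ∃ μ, 0 < μ ∧ Tendsto (fun k => q ^ k * e (l + k * Z)) atTop (𝓝 μ) := by
    intro l
    refine exists_tendsto_geometric (D := 2 * C) hq0 hq1 (fun k => ?_) ?_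
    · have h1 := hup (l + k * Z)
      have h2 := hlow (l + k * Z)
      have h3 : l + (k + 1) * Z = l + k * Z + Z := by ring
      rw [h3, abs_le]
      constructor <;> linarith
    · refine htop.comp (tendsto_atTop_mono (fun k => ?_) tendsto_id)
      have : k * 1 ≤ k * Z := Nat.mul_le_mul_left k hZ
      simp only [id]; omega
  choose μ hμ using hprog
  refine ⟨fun k => e (k - 1), ?_, ?_, fun l => μ (l - 1), fun l hl => ⟨(hμ _).1, ?_⟩⟩
  · intro k hk l hl hkl
    simp only [Set.mem_Ici] at hk hl
    exact he (by omega)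
  · ext x
    constructor
    · rintro ⟨k, -, rfl⟩
      exact ⟨k - 1, rfl⟩
    · rintro ⟨k, rfl⟩
      exact ⟨k + 1, by simp, by simp⟩
  · have hl1 : 1 ≤ l := (Finset.mem_Icc.1 hl).1
    have hμ0 := (hμ (l - 1)).1
    refine (isEquivalent_iff_tendsto_one ?_).2 ?_
    · exact Eventually.of_forall fun k => mul_ne_zero hμ0.ne' (zpow_ne_zero _ hq0.ne')
    · have h := (hμ (l - 1)).2.div_const (μ (l - 1))
      rw [div_self hμ0.ne'] at h
      refine h.congr fun k => ?_
      have : l + k * Z - 1 = l - 1 + k * Z := by omega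
      simp only [Pi.div_apply, this, zpow_neg, zpow_natCast]
      field_simp

/-! ### Variational principle for compact symmetric operators -/

section Variational

variable {H : Type*} [NormedAddCommGroup H] [InnerProductSpace ℂ H]

/-- The positive characteristic values of `K`: the numbers `r > 0` such that `x = r K x` has a
nonzero solution, i.e. the reciprocals of the positive eigenvalues of `K`. -/
def charValues (K : H →L[ℂ] H) : Set ℝ := {r | 0 < r ∧ ∃ x : H, x ≠ 0 ∧ x = (r : ℂ) • K x}

/-- All positive characteristic values of `K` are simple. -/
def HasSimpleCharValues (K : H →L[ℂ] H) : Prop :=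
  ∀ r : ℝ, 0 < r → ∀ x y : H, x ≠ 0 → x = (r : ℂ) • K x → y = (r : ℂ) • K y → ∃ c : ℂ, y = c • x

theorem apply_eq_inv_smul_iff {K : H →L[ℂ] H} {r : ℝ} (hr : 0 < r) {x : H} :
    x = (r : ℂ) • K x ↔ K x = ((r⁻¹ : ℝ) : ℂ) • x := by
  have hr' : (r : ℂ) ≠ 0 := by exact_mod_cast hr.ne'
  rw [Complex.ofReal_inv, eq_inv_smul_iff₀ hr', eq_comm]

theorem norm_sub_sq_of_inner_eq_zero {x y : H} (h : inner ℂ x y = 0) :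
    ‖x - y‖ ^ 2 = ‖x‖ ^ 2 + ‖y‖ ^ 2 := by
  rw [norm_sub_sq (𝕜 := ℂ), h]; simp

theorem inner_self_eq_ofReal (x : H) : inner ℂ x x = ((‖x‖ ^ 2 : ℝ) : ℂ) := by
  rw [inner_self_eq_norm_sq_to_K]
  push_cast
  rfl

/-- If `w` is orthogonal to all eigenvectors of the compact symmetric operator `K` with eigenvalues
above `μ`, then `⟪K w, w⟫ ≤ μ ‖w‖ ^ 2`. Finite sums of eigenvectors are dense, and dropping from
such a sum the terms to which `w` is orthogonal only brings it closer to `w`. -/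
theorem reApplyInnerSelf_le_of_orthogonal [CompleteSpace H] {K : H →L[ℂ] H}
    (hK : IsCompactOperator K) (hS : (K : H →ₗ[ℂ] H).IsSymmetric) {μ : ℝ} {w : H}
    (hw : ∀ ν : ℝ, μ < ν → ∀ x : H, K x = (ν : ℂ) • x → inner ℂ x w = 0) :
    K.reApplyInnerSelf w ≤ μ * ‖w‖ ^ 2 := by
  classical
  have hdense : (⨆ ν, Module.End.eigenspace (K : Module.End ℂ H) ν).topologicalClosure = ⊤ :=
    (Submodule.topologicalClosure_eq_top_iff).2
      (K.orthogonalComplement_iSup_eigenspaces_eq_bot hK hS)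
  have hclosed : IsClosed {x : H | K.reApplyInnerSelf x ≤ μ * ‖x‖ ^ 2} :=
    isClosed_le K.reApplyInnerSelf_continuous (by fun_prop)
  refine hclosed.closure_subset (Metric.mem_closure_iff.2 fun ε hε => ?_)
  have hwmem : w ∈ closure ((⨆ ν, Module.End.eigenspace (K : Module.End ℂ H) ν :
      Submodule ℂ H) : Set H) := by
    rw [← Submodule.topologicalClosure_coe, hdense]; trivial
  obtain ⟨x, hx, hwx⟩ := Metric.mem_closure_iff.1 hwmem ε hε
  obtain ⟨f, hf, rfl⟩ := (Submodule.mem_iSup_iff_exists_finsupp _ _).1 hx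
  have horth := hS.orthogonalFamily_eigenspaces
  have hinner : ∀ (s t : Finset ℂ) (p : ℂ → ℂ), inner ℂ (∑ ν ∈ s, p ν • f ν) (∑ ν ∈ t, f ν) =
      ∑ ν ∈ s ∩ t, conj (p ν) * (‖f ν‖ ^ 2 : ℝ) := by
    intro s t p
    rw [sum_inner, ← Finset.sum_ite_mem]
    refine Finset.sum_congr rfl fun ν hν => ?_
    rw [inner_sum]
    have h0 : ∀ ν' ∈ t, ν' ≠ ν → inner ℂ (p ν • f ν) (f ν') = 0 := fun ν' _ hne => by
      rw [inner_smul_left]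
      have := horth hne.symm ⟨f ν, hf ν⟩ ⟨f ν', hf ν'⟩
      simp only [Submodule.coe_subtypeₗᵢ, Submodule.coe_subtype] at this
      rw [this, mul_zero]
    split_ifs with h
    · rw [Finset.sum_eq_single ν h0 (fun h' => absurd h h'), inner_smul_left,
        inner_self_eq_ofReal]
    · exact Finset.sum_eq_zero fun ν' hν' => h0 ν' hν' (fun h' => h (h' ▸ hν'))
  set s := f.support with hs
  set lo := s.filter (fun ν => ¬ μ < ν.re) with hlo
  set hi := s.filter (fun ν => μ < ν.re) with hhi
  have hKf : ∀ ν, K (f ν) = ν • f ν := fun ν => Module.End.mem_eigenspace_iff.1 (hf ν)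
  have hhiw : inner ℂ (∑ ν ∈ hi, f ν) w = 0 := by
    rw [sum_inner]
    refine Finset.sum_eq_zero fun ν hν => ?_
    have hνμ : μ < ν.re := (Finset.mem_filter.1 hν).2
    have hf0 : f ν ≠ 0 := Finsupp.mem_support_iff.1 (Finset.mem_filter.1 hν).1
    have hreal : conj ν = ν := hS.conj_eigenvalue_eq_self
      (Module.End.hasEigenvalue_of_hasEigenvector ⟨hf ν, hf0⟩)
    refine hw ν.re hνμ (f ν) ?_
    rw [hKf, Complex.conj_eq_iff_re.1 hreal]
  have hdisj : hi ∩ lo = ∅ :=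
    Finset.disjoint_iff_inter_eq_empty.1 (Finset.disjoint_filter_filter_not _ _ _)
  have hhilo : inner ℂ (∑ ν ∈ hi, f ν) (∑ ν ∈ lo, f ν) = 0 := by
    have := hinner hi lo (fun _ => 1)
    rw [hdisj] at this
    simpa using this
  refine ⟨∑ ν ∈ lo, f ν, ?_, lt_of_le_of_lt ?_ hwx⟩
  · have hb : K.reApplyInnerSelf (∑ ν ∈ lo, f ν) = ∑ ν ∈ lo, ν.re * ‖f ν‖ ^ 2 := by
      rw [ContinuousLinearMap.reApplyInnerSelf_apply, map_sum]
      simp_rw [hKf]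
      rw [hinner lo lo (fun ν => ν), Finset.inter_self, map_sum]
      refine Finset.sum_congr rfl fun ν _ => ?_
      rw [RCLike.re_eq_complex_re, Complex.re_mul_ofReal, Complex.conj_re]
    have hn : ‖∑ ν ∈ lo, f ν‖ ^ 2 = ∑ ν ∈ lo, ‖f ν‖ ^ 2 := by
      have := hinner lo lo (fun _ => 1)
      simp only [one_smul, map_one, one_mul, Finset.inter_self] at this
      rw [inner_self_eq_ofReal] at this
      exact_mod_cast this
    change K.reApplyInnerSelf _ ≤ _
    rw [hb, hn, Finset.mul_sum]
    refine Finset.sum_le_sum fun ν hν => mul_le_mul_of_nonneg_right ?_ (by positivity)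
    exact not_lt.1 (Finset.mem_filter.1 hν).2
  · have hsum : (f.sum fun _ xi => xi) = ∑ ν ∈ hi, f ν + ∑ ν ∈ lo, f ν := by
      rw [Finsupp.sum, hhi, hlo, Finset.sum_filter_add_sum_filter_not]
    rw [hsum, dist_eq_norm, dist_eq_norm]
    have h0 : inner ℂ (w - ∑ ν ∈ lo, f ν) (∑ ν ∈ hi, f ν) = 0 := by
      rw [← inner_conj_symm, inner_sub_right, hhiw, hhilo]; simp
    have h1 := norm_sub_sq_of_inner_eq_zero h0
    have h2 : w - ∑ ν ∈ lo, f ν - ∑ ν ∈ hi, f ν = w - (∑ ν ∈ hi, f ν + ∑ ν ∈ lo, f ν) := by abel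
    rw [h2] at h1
    nlinarith [norm_nonneg (w - ∑ ν ∈ lo, f ν), norm_nonneg (∑ ν ∈ hi, f ν),
      norm_nonneg (w - (∑ ν ∈ hi, f ν + ∑ ν ∈ lo, f ν))]

/-- Normalized eigenvectors of `K` for all the positive characteristic values. -/
theorem exists_normalized_eigenvectors {K : H →L[ℂ] H} (hS : (K : H →ₗ[ℂ] H).IsSymmetric) :
    ∃ e : charValues K → H, Orthonormal ℂ e ∧ ∀ r, K (e r) = ((r.1⁻¹ : ℝ) : ℂ) • e r := by
  have h : ∀ r : charValues K, ∃ x : H, ‖x‖ = 1 ∧ K x = ((r.1⁻¹ : ℝ) : ℂ) • x := by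
    rintro ⟨r, hr, x, hx, hxr⟩
    refine ⟨((‖x‖⁻¹ : ℝ) : ℂ) • x, ?_, ?_⟩
    · rw [norm_smul]
      simp [hx]
    · have hKx := (apply_eq_inv_smul_iff hr).1 hxr
      change K (((‖x‖⁻¹ : ℝ) : ℂ) • x) = ((r⁻¹ : ℝ) : ℂ) • ((‖x‖⁻¹ : ℝ) : ℂ) • x
      rw [map_smul, hKx, smul_comm]
  choose e he1 he2 using h
  refine ⟨e, ⟨he1, fun r r' hrr' => ?_⟩, he2⟩
  have hne : ((r.1⁻¹ : ℝ) : ℂ) ≠ ((r'.1⁻¹ : ℝ) : ℂ) := by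
    intro h
    exact hrr' (Subtype.ext (inv_injective (Complex.ofReal_injective h)))
  exact hS.orthogonalFamily_eigenspaces hne
    ⟨e r, Module.End.mem_eigenspace_iff.2 (he2 r)⟩ ⟨e r', Module.End.mem_eigenspace_iff.2 (he2 r')⟩

theorem finite_charValues_inter_Iio {K : H →L[ℂ] H}
    (hK : IsCompactOperator K) (hS : (K : H →ₗ[ℂ] H).IsSymmetric) (R : ℝ) :
    (charValues K ∩ Set.Iio R).Finite := by
  obtain ⟨e, he, hKe⟩ := exists_normalized_eigenvectors hS
  by_contra hinf
  let u : ℕ ↪ ↥(charValues K ∩ Set.Iio R) := Set.Infinite.natEmbedding _ hinf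
  let r : ℕ → charValues K := fun i => ⟨(u i).1, (u i).2.1⟩
  have hrinj : Function.Injective r := fun i j hij =>
    u.injective (Subtype.ext (congrArg (fun x : charValues K => x.1) hij))
  have hr0 : ∀ i, 0 < (r i).1 := fun i => (r i).2.1
  have hrR : ∀ i, (r i).1 < R := fun i => (u i).2.2
  have hR : 0 < R := (hr0 0).trans (hrR 0)
  have hcomp : IsCompact (closure (K '' Metric.closedBall 0 1)) :=
    IsCompactOperator.isCompact_closure_image_closedBall (f := (K : H →ₗ[ℂ] H)) hK 1
  obtain ⟨y, -, φ, hφ, hy⟩ := hcomp.tendsto_subseq (x := fun i => K (e (r i))) (fun i =>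
    subset_closure ⟨e (r i), by simp [he.1 (r i)], rfl⟩)
  obtain ⟨N, hN⟩ := Metric.cauchySeq_iff'.1 hy.cauchySeq R⁻¹ (by positivity)
  have h1 := hN (N + 1) (by omega)
  simp only [Function.comp_apply, hKe, dist_eq_norm] at h1
  set i := φ (N + 1)
  set j := φ N
  have hij : r i ≠ r j := fun h => by
    have := hφ.injective (hrinj h); omega
  have h0 : inner ℂ ((((r i).1⁻¹ : ℝ) : ℂ) • e (r i)) ((((r j).1⁻¹ : ℝ) : ℂ) • e (r j)) = 0 := by
    rw [inner_smul_left, inner_smul_right, he.2 hij]; simp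
  have h2 := norm_sub_sq_of_inner_eq_zero h0
  have h3 : ‖(((r i).1⁻¹ : ℝ) : ℂ) • e (r i)‖ = (r i).1⁻¹ := by
    rw [norm_smul, he.1, mul_one, Complex.norm_real, Real.norm_of_nonneg (inv_pos.2 (hr0 i)).le]
  rw [h3] at h2
  have h4 : R⁻¹ < (r i).1⁻¹ := (inv_lt_inv₀ hR (hr0 i)).2 (hrR i)
  have hRi : 0 < R⁻¹ := by positivity
  nlinarith [norm_nonneg ((((r j).1⁻¹ : ℝ) : ℂ) • e (r j)),
    norm_nonneg ((((r i).1⁻¹ : ℝ) : ℂ) • e (r i) - (((r j).1⁻¹ : ℝ) : ℂ) • e (r j))]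

variable {K : H →L[ℂ] H}

theorem norm_sq_sum_eigenvectors {e : charValues K → H} (he : Orthonormal ℂ e)
    {κ : Type*} [Fintype κ] {s : κ → charValues K} (hs : Function.Injective s) (c : κ → ℂ) :
    ‖∑ i, c i • e (s i)‖ ^ 2 = ∑ i, ‖c i‖ ^ 2 := by
  have h := (he.comp s hs).inner_sum c c Finset.univ
  simp only [Function.comp_apply] at h
  rw [inner_self_eq_ofReal] at h
  have h2 : ∀ i, conj (c i) * c i = ((‖c i‖ ^ 2 : ℝ) : ℂ) := fun i => by
    rw [← Complex.normSq_eq_conj_mul_self, Complex.normSq_eq_norm_sq]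
  simp_rw [h2] at h
  exact_mod_cast h

theorem reApplyInnerSelf_sum_eigenvectors {e : charValues K → H} (he : Orthonormal ℂ e)
    (hKe : ∀ r, K (e r) = ((r.1⁻¹ : ℝ) : ℂ) • e r) {κ : Type*} [Fintype κ]
    {s : κ → charValues K} (hs : Function.Injective s) (c : κ → ℂ) :
    K.reApplyInnerSelf (∑ i, c i • e (s i)) = ∑ i, (s i).1⁻¹ * ‖c i‖ ^ 2 := by
  rw [ContinuousLinearMap.reApplyInnerSelf_apply, map_sum]
  simp_rw [map_smul, hKe, smul_smul]
  have h := (he.comp s hs).inner_sum (fun i => c i * (((s i).1⁻¹ : ℝ) : ℂ)) c Finset.univ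
  simp only [Function.comp_apply] at h
  rw [h, map_sum]
  refine Finset.sum_congr rfl fun i _ => ?_
  have h2 : conj (c i) * c i = ((‖c i‖ ^ 2 : ℝ) : ℂ) := by
    rw [← Complex.normSq_eq_conj_mul_self, Complex.normSq_eq_norm_sq]
  have h3 : conj (c i * (((s i).1⁻¹ : ℝ) : ℂ)) * c i = (((s i).1⁻¹ * ‖c i‖ ^ 2 : ℝ) : ℂ) := by
    rw [map_mul, Complex.conj_ofReal, mul_right_comm, h2, ← Complex.ofReal_mul, mul_comm]
  rw [h3, RCLike.re_eq_complex_re, Complex.ofReal_re]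

/-- On the orthogonal complement of the eigenvectors with characteristic values below `r`, the
form `‖x‖ ^ 2 - r ⟪K x, x⟫` is nonnegative. -/
theorem mul_reApplyInnerSelf_le_of_inner_eq_zero [CompleteSpace H] (hK : IsCompactOperator K)
    (hS : (K : H →ₗ[ℂ] H).IsSymmetric) (hsimple : HasSimpleCharValues K)
    {e : charValues K → H} (he : Orthonormal ℂ e)
    (hKe : ∀ r, K (e r) = ((r.1⁻¹ : ℝ) : ℂ) • e r) {r : ℝ} (hr : 0 < r) {x : H}
    (hx : ∀ i : charValues K, i.1 < r → inner ℂ (e i) x = 0) :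
    r * K.reApplyInnerSelf x ≤ ‖x‖ ^ 2 := by
  have h := reApplyInnerSelf_le_of_orthogonal hK hS (μ := r⁻¹) (w := x) fun ν hν y hy => by
    by_cases hy0 : y = 0
    · simp [hy0]
    have hν0 : 0 < ν := (inv_pos.2 hr).trans hν
    have hy' : y = ((ν⁻¹ : ℝ) : ℂ) • K y :=
      (apply_eq_inv_smul_iff (inv_pos.2 hν0)).2 (by rw [inv_inv]; exact hy)
    let i : charValues K := ⟨ν⁻¹, inv_pos.2 hν0, y, hy0, hy'⟩
    obtain ⟨c, hc⟩ := hsimple ν⁻¹ (inv_pos.2 hν0) (e i) y (he.ne_zero i)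
      ((apply_eq_inv_smul_iff (inv_pos.2 hν0)).2 (hKe i)) hy'
    rw [hc, inner_smul_left, hx i (inv_lt_of_inv_lt₀ hr hν), mul_zero]
  rwa [inv_mul_eq_div, le_div_iff₀ hr, mul_comm] at h

/-- A space on which `‖x‖ ^ 2 - r ⟪K x, x⟫` is negative has at most as many dimensions as there are
characteristic values below `r`. -/
theorem finrank_le_ncard_of_neg [CompleteSpace H] (hK : IsCompactOperator K)
    (hS : (K : H →ₗ[ℂ] H).IsSymmetric) (hsimple : HasSimpleCharValues K)
    {V : Type*} [AddCommGroup V] [Module ℂ V] [FiniteDimensional ℂ V] (g : V →ₗ[ℂ] H) {r : ℝ}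
    (hr : 0 < r) (hg : ∀ v, v ≠ 0 → ‖g v‖ ^ 2 < r * K.reApplyInnerSelf (g v)) :
    Module.finrank ℂ V ≤ (charValues K ∩ Set.Iio r).ncard := by
  obtain ⟨e, he, hKe⟩ := exists_normalized_eigenvectors hS
  have hfin := finite_charValues_inter_Iio hK hS r
  have : Fintype ↥(charValues K ∩ Set.Iio r) := hfin.fintype
  by_contra! hlt
  let f : V →ₗ[ℂ] (↥(charValues K ∩ Set.Iio r) → ℂ) :=
    LinearMap.pi fun i => (innerSL ℂ (e ⟨i.1, i.2.1⟩) : H →ₗ[ℂ] ℂ) ∘ₗ g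
  have hcard : Module.finrank ℂ (↥(charValues K ∩ Set.Iio r) → ℂ) =
      (charValues K ∩ Set.Iio r).ncard := by
    rw [Module.finrank_fintype_fun_eq_card, ← Nat.card_eq_fintype_card, Nat.card_coe_set_eq]
  obtain ⟨v, hv, hv0⟩ := (Submodule.ne_bot_iff _).1
    (LinearMap.ker_ne_bot_of_finrank_lt (f := f) (by rwa [hcard]))
  refine absurd (hg v hv0) (not_lt.2 ?_)
  refine mul_reApplyInnerSelf_le_of_inner_eq_zero hK hS hsimple he hKe hr fun i hi => ?_
  exact congrFun (LinearMap.mem_ker.1 hv) ⟨i.1, i.2, hi⟩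

/-- If `‖x‖ ^ 2 - r ⟪K x, x⟫` is nonnegative on the kernel of a linear map to a space `V`, then
there are at most `dim V` characteristic values below `r`. -/
theorem ncard_le_finrank_of_nonneg (hK : IsCompactOperator K)
    (hS : (K : H →ₗ[ℂ] H).IsSymmetric)
    {V : Type*} [AddCommGroup V] [Module ℂ V] [FiniteDimensional ℂ V] (f : H →ₗ[ℂ] V) {r : ℝ}
    (hf : ∀ x, f x = 0 → r * K.reApplyInnerSelf x ≤ ‖x‖ ^ 2) :
    (charValues K ∩ Set.Iio r).ncard ≤ Module.finrank ℂ V := by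
  obtain ⟨e, he, hKe⟩ := exists_normalized_eigenvectors hS
  have hfin := finite_charValues_inter_Iio hK hS r
  have : Fintype ↥(charValues K ∩ Set.Iio r) := hfin.fintype
  by_contra! hlt
  let s : ↥(charValues K ∩ Set.Iio r) → charValues K := fun i => ⟨i.1, i.2.1⟩
  have hs : Function.Injective s := fun i j hij =>
    Subtype.ext (congrArg (fun x : charValues K => x.1) hij)
  let g := Fintype.linearCombination ℂ (fun i => e (s i))
  have hg : ∀ c, g c = ∑ i, c i • e (s i) := fun c => Fintype.linearCombination_apply _ _ _
  have hcard : Module.finrank ℂ (↥(charValues K ∩ Set.Iio r) → ℂ) =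
      (charValues K ∩ Set.Iio r).ncard := by
    rw [Module.finrank_fintype_fun_eq_card, ← Nat.card_eq_fintype_card, Nat.card_coe_set_eq]
  obtain ⟨c, hc, hc0⟩ := (Submodule.ne_bot_iff _).1
    (LinearMap.ker_ne_bot_of_finrank_lt (f := f ∘ₗ g) (by rwa [hcard]))
  have h := hf (g c) (LinearMap.mem_ker.1 hc)
  rw [hg, norm_sq_sum_eigenvectors he hs, reApplyInnerSelf_sum_eigenvectors he hKe hs,
    Finset.mul_sum] at h
  refine absurd h (not_le.2 ?_)
  have hr : ∀ i, 1 < r * (s i).1⁻¹ := fun i => by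
    rw [← div_eq_mul_inv, one_lt_div i.2.1.1]; exact i.2.2
  obtain ⟨i, hi⟩ := Function.ne_iff.1 hc0
  refine Finset.sum_lt_sum (fun j _ => ?_) ⟨i, Finset.mem_univ i, ?_⟩
  · rw [← mul_assoc]
    exact le_mul_of_one_le_left (by positivity) (hr j).le
  · rw [← mul_assoc]
    exact lt_mul_of_one_lt_left (by have := norm_pos_iff.2 hi; positivity) (hr i)

end Variational

/-! ### Operators with a self-similar quadratic form -/

section Decomposition

variable {H : Type*} [NormedAddCommGroup H] [InnerProductSpace ℂ H]

/-- The self-similar structure of the form `⟪K y, y⟫`: up to point evaluations `ev k`, which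
carry the weights `ζ k`, it is a rescaled copy of itself. The map `J` inserts a rescaled copy of a
vector, `R` reads it off again, and `h k` are vectors dual to the evaluations on which the form is
diagonal. -/
structure SimilarityDecomposition (K : H →L[ℂ] H) {ι : Type*} [Fintype ι] [DecidableEq ι]
    (ζ : ι → ℝ) (a d : ℝ) where
  /-- Insertion of a rescaled copy. -/
  J : H →ₗ[ℂ] H
  /-- The rescaled copy contained in a vector, for vectors on which all `ev k` vanish. -/
  R : H →ₗ[ℂ] H
  /-- The vectors dual to the evaluations. -/
  h : ι → H
  /-- The evaluations. -/
  ev : ι → H →ₗ[ℂ] ℂ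
  norm_J : ∀ u, ‖J u‖ ^ 2 = a⁻¹ * ‖u‖ ^ 2
  ev_J : ∀ k u, ev k (J u) = 0
  ev_h : ∀ k j, ev k (h j) = if k = j then 1 else 0
  inner_h : ∀ k y, inner ℂ (h k) (K y) = ζ k * ev k y
  form_J : ∀ u, K.reApplyInnerSelf (J u) = d * K.reApplyInnerSelf u
  form_of_ev_eq_zero : ∀ v, (∀ k, ev k v = 0) →
    K.reApplyInnerSelf v = d * K.reApplyInnerSelf (R v)
  inner_J_R : ∀ v, (∀ k, ev k v = 0) → inner ℂ (J (R v)) (v - J (R v)) = 0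

/-- The weighted Young inequality for the square of a sum. -/
theorem add_sq_le_weighted {x y t : ℝ} (ht : 0 < t) :
    (x + y) ^ 2 ≤ (1 + t) * x ^ 2 + (1 + t⁻¹) * y ^ 2 := by
  have h : (1 + t) * x ^ 2 + (1 + t⁻¹) * y ^ 2 - (x + y) ^ 2 = t⁻¹ * (t * x - y) ^ 2 := by
    field_simp; ring
  have : 0 ≤ t⁻¹ * (t * x - y) ^ 2 := by positivity
  linarith

namespace SimilarityDecomposition

variable {K : H →L[ℂ] H} {ι : Type*} [Fintype ι] [DecidableEq ι] {ζ : ι → ℝ} {a d : ℝ}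
  (D : SimilarityDecomposition K ζ a d)

theorem ev_sum (c : ι → ℂ) (k : ι) : D.ev k (∑ j, c j • D.h j) = c k := by
  simp [D.ev_h]

theorem form_add_sum (hS : (K : H →ₗ[ℂ] H).IsSymmetric) {v : H} (hv : ∀ k, D.ev k v = 0)
    (c : ι → ℂ) : K.reApplyInnerSelf (v + ∑ k, c k • D.h k) =
      K.reApplyInnerSelf v + ∑ k, ζ k * ‖c k‖ ^ 2 := by
  set w := ∑ k, c k • D.h k with hw
  have h1 : ∀ y, inner ℂ w (K y) = ∑ k, conj (c k) * (ζ k * D.ev k y) := fun y => by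
    rw [hw, sum_inner]
    simp_rw [inner_smul_left, D.inner_h]
  have h2 : inner ℂ w (K v) = 0 := by rw [h1]; simp [hv]
  have h3 : inner ℂ (K v) w = 0 := by rw [← inner_conj_symm, h2]; simp
  have h4 : inner ℂ (K w) v = 0 := (hS w v).trans h2
  have h5 : inner ℂ (K w) w = ((∑ k, ζ k * ‖c k‖ ^ 2 : ℝ) : ℂ) := by
    have h6 : inner ℂ (K w) w = inner ℂ w (K w) := hS w w
    rw [h6, h1]
    push_cast
    refine Finset.sum_congr rfl fun k _ => ?_
    rw [hw, D.ev_sum, ← Complex.conj_mul']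
    ring
  simp only [ContinuousLinearMap.reApplyInnerSelf_apply, map_add, inner_add_left, inner_add_right,
    h3, h4, h5, map_add, RCLike.re_eq_complex_re, Complex.ofReal_re, Complex.zero_re]
  ring

theorem norm_sq_sum_le (c : ι → ℂ) :
    ‖∑ k, c k • D.h k‖ ^ 2 ≤ (∑ k, ‖D.h k‖ ^ 2) * ∑ k, ‖c k‖ ^ 2 := by
  have h1 : ‖∑ k, c k • D.h k‖ ≤ ∑ k, ‖D.h k‖ * ‖c k‖ := by
    refine (norm_sum_le _ _).trans_eq (Finset.sum_congr rfl fun k _ => ?_)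
    rw [norm_smul, mul_comm]
  calc ‖∑ k, c k • D.h k‖ ^ 2 ≤ (∑ k, ‖D.h k‖ * ‖c k‖) ^ 2 := by gcongr
    _ ≤ _ := Finset.sum_mul_sq_le_sq_mul_sq _ _ _

/-- On the sum of a rescaled copy of a vector with `‖u‖ ^ 2 ≤ r ⟪K u, u⟫` and of the vectors `h k`
with positive weights, `‖x‖ ^ 2 - ((r + C) / (a d)) ⟪K x, x⟫` is negative. -/
theorem form_neg (hS : (K : H →ₗ[ℂ] H).IsSymmetric) (ha : 0 < a) (hd : 0 < d) {ζ₀ C r : ℝ}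
    (hζ : ∀ k, 0 < ζ k → ζ₀ ≤ ζ k) (hC : 0 < C)
    (hCM : ∑ k, ‖D.h k‖ ^ 2 < C * ζ₀ / (a * d)) (hr : 0 ≤ r) {u : H} {c : ι → ℂ}
    (hu : ‖u‖ ^ 2 ≤ r * K.reApplyInnerSelf u) (hc : ∀ k, c k ≠ 0 → 0 < ζ k)
    (hne : u ≠ 0 ∨ c ≠ 0) :
    ‖D.J u + ∑ k, c k • D.h k‖ ^ 2 <
      (r + C) / (a * d) * K.reApplyInnerSelf (D.J u + ∑ k, c k • D.h k) := by
  set M := ∑ k, ‖D.h k‖ ^ 2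
  set Y := ∑ k, ‖c k‖ ^ 2 with hY
  have hY0 : 0 ≤ Y := Finset.sum_nonneg fun k _ => by positivity
  have hMY := D.norm_sq_sum_le c
  have hζY : ζ₀ * Y ≤ ∑ k, ζ k * ‖c k‖ ^ 2 := by
    rw [hY, Finset.mul_sum]
    refine Finset.sum_le_sum fun k _ => ?_
    by_cases hk : c k = 0
    · simp [hk]
    · exact mul_le_mul_of_nonneg_right (hζ k (hc k hk)) (by positivity)
  have hM0 : 0 ≤ M := Finset.sum_nonneg fun k _ => by positivity
  rw [D.form_add_sum hS (fun k => D.ev_J k u), D.form_J]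
  set b := K.reApplyInnerSelf u with hb
  have hJ := D.norm_J u
  have htri : ‖D.J u + ∑ k, c k • D.h k‖ ^ 2 ≤ (‖D.J u‖ + ‖∑ k, c k • D.h k‖) ^ 2 := by
    gcongr; exact norm_add_le _ _
  have hrC : 0 < (r + C) / (a * d) := by positivity
  have hsplit : (r + C) / (a * d) * (d * b) = (r + C) * (a⁻¹ * b) := by field_simp
  have hfin : M * Y * ((r + C) / C) ≤ (r + C) / (a * d) * (ζ₀ * Y) := by
    have h1 := mul_le_mul_of_nonneg_right hCM.le (show 0 ≤ Y * ((r + C) / C) by positivity)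
    calc _ = M * (Y * ((r + C) / C)) := by ring
      _ ≤ _ := h1
      _ = _ := by field_simp
  have hfin' : 0 < Y → M * Y * ((r + C) / C) < (r + C) / (a * d) * (ζ₀ * Y) := fun hYp => by
    have h1 := mul_lt_mul_of_pos_right hCM (show 0 < Y * ((r + C) / C) by positivity)
    calc _ = M * (Y * ((r + C) / C)) := by ring
      _ < _ := h1
      _ = _ := by field_simp
  have hζY' := mul_le_mul_of_nonneg_left hζY hrC.le
  rw [mul_add, hsplit]
  rcases hr.eq_or_lt with rfl | hr
  · -- here `u = 0`, so that only the weights matter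
    have hu0 : u = 0 := by
      have : ‖u‖ ^ 2 ≤ 0 := by simpa using hu
      simpa using this
    have hcne : 0 < Y := by
      obtain ⟨k, hk⟩ := Function.ne_iff.1 (hne.resolve_left (not_not.2 hu0))
      have := norm_pos_iff.2 hk
      exact Finset.sum_pos' (fun k _ => by positivity) ⟨k, Finset.mem_univ k, by positivity⟩
    have hb0 : b = 0 := by simp [hb, hu0, ContinuousLinearMap.reApplyInnerSelf_apply]
    have := hfin' hcne
    rw [zero_add, div_self hC.ne', mul_one] at this
    rw [hu0, map_zero, zero_add, hb0]
    rw [zero_add] at hζY'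
    have h0 : (0 + C) * (a⁻¹ * 0) = 0 := by ring
    rw [h0, zero_add, zero_add]
    exact (hMY.trans_lt this).trans_le hζY'
  · -- the weight `C / r` balances the two terms
    have hw := add_sq_le_weighted (x := ‖D.J u‖) (y := ‖∑ k, c k • D.h k‖) (div_pos hC hr)
    have h1 : (1 + C / r) * ‖D.J u‖ ^ 2 ≤ (r + C) * (a⁻¹ * b) := by
      rw [hJ]
      have : (1 + C / r) * (a⁻¹ * ‖u‖ ^ 2) ≤ (1 + C / r) * (a⁻¹ * (r * b)) := by gcongr
      refine this.trans_eq ?_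
      field_simp
    have h2 : (1 + (C / r)⁻¹) * ‖∑ k, c k • D.h k‖ ^ 2 ≤ M * Y * ((r + C) / C) := by
      have h3 : 1 + (C / r)⁻¹ = (r + C) / C := by field_simp; ring
      rw [h3, mul_comm]
      gcongr
    rcases hY0.eq_or_lt with hY' | hY'
    · have hc0 : c = 0 := by
        funext k
        have := (Finset.sum_eq_zero_iff_of_nonneg (fun k _ => by positivity)).1 hY'.symm k
          (Finset.mem_univ k)
        simpa using this
      have hu0 : 0 < ‖u‖ ^ 2 := by
        have := norm_pos_iff.2 (hne.resolve_right (not_not.2 hc0)); positivity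
      have hbpos : 0 < b := pos_of_mul_pos_right (hu0.trans_le hu) hr.le
      have h4 : a⁻¹ * ‖u‖ ^ 2 < (r + C) * (a⁻¹ * b) := by
        have : ‖u‖ ^ 2 < (r + C) * b := by nlinarith
        calc a⁻¹ * ‖u‖ ^ 2 < a⁻¹ * ((r + C) * b) := by gcongr
          _ = _ := by ring
      rw [hc0]
      simpa [hJ] using h4
    · have := hfin' hY'
      linarith

/-- If `‖R v‖ ^ 2 - r ⟪K (R v), R v⟫` is nonnegative for the part `v` of `y` without point values,
and all point values of `y` with positive weights vanish, then
`‖y‖ ^ 2 - ((r - C) / (a d)) ⟪K y, y⟫` is nonnegative. -/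
theorem form_nonneg (hS : (K : H →ₗ[ℂ] H).IsSymmetric) (ha : 0 < a) (hd : 0 < d) {ζ₀ C r : ℝ}
    (hζ : ∀ k, ζ k ≤ 0 → ζ k ≤ -ζ₀) (hζ₀ : 0 < ζ₀) (hC : 0 < C)
    (hCM : 2 * ∑ k, ‖D.h k‖ ^ 2 < C * ζ₀ / (a * d)) (hr : 2 * C < r) {y : H}
    (hy : ∀ k, 0 < ζ k → D.ev k y = 0)
    (hRy : r * K.reApplyInnerSelf (D.R (y - ∑ k, D.ev k y • D.h k)) ≤
      ‖D.R (y - ∑ k, D.ev k y • D.h k)‖ ^ 2) :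
    (r - C) / (a * d) * K.reApplyInnerSelf y ≤ ‖y‖ ^ 2 := by
  set c : ι → ℂ := fun k => D.ev k y with hc
  set w := ∑ k, D.ev k y • D.h k with hw
  set v := y - w with hv
  have hevv : ∀ k, D.ev k v = 0 := fun k => by
    rw [hv, map_sub, hw, D.ev_sum (fun k => D.ev k y), sub_self]
  have hyvw : y = v + w := by rw [hv]; abel
  set u := D.R v with hu
  set M := ∑ k, ‖D.h k‖ ^ 2
  set Y := ∑ k, ‖c k‖ ^ 2 with hY
  have hY0 : 0 ≤ Y := Finset.sum_nonneg fun k _ => by positivity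
  have hMY : ‖w‖ ^ 2 ≤ M * Y := D.norm_sq_sum_le c
  have hform : K.reApplyInnerSelf y = d * K.reApplyInnerSelf u + ∑ k, ζ k * ‖c k‖ ^ 2 := by
    conv_lhs => rw [hyvw]
    rw [hw, D.form_add_sum hS hevv c, D.form_of_ev_eq_zero v hevv]
  have hζY : ∑ k, ζ k * ‖c k‖ ^ 2 ≤ -ζ₀ * Y := by
    rw [hY, Finset.mul_sum]
    refine Finset.sum_le_sum fun k _ => ?_
    by_cases hk : 0 < ζ k
    · simp [hc, hy k hk]
    · exact mul_le_mul_of_nonneg_right (hζ k (not_lt.1 hk)) (by positivity)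
  have hJ := D.norm_J u
  set b := K.reApplyInnerSelf u with hb
  have hr0 : 0 < r := by linarith
  -- the remainder `v - J u` is orthogonal to `J u` and can be dropped
  have hnorm : ‖D.J u‖ ^ 2 - 2 * (‖D.J u‖ * ‖w‖) ≤ ‖y‖ ^ 2 := by
    have h0 : inner ℂ (D.J u) (v - D.J u) = 0 := D.inner_J_R v hevv
    have hsum : y = D.J u + (v - D.J u + w) := by rw [hyvw]; abel
    have h1 : ‖y‖ ^ 2 = ‖D.J u‖ ^ 2 + 2 * RCLike.re (inner ℂ (D.J u) w) + ‖v - D.J u + w‖ ^ 2 := by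
      rw [hsum, norm_add_sq (𝕜 := ℂ), inner_add_right, h0, zero_add]
    have h2 : -(‖D.J u‖ * ‖w‖) ≤ RCLike.re (inner ℂ (D.J u) w) :=
      (abs_le.1 ((RCLike.abs_re_le_norm _).trans (norm_inner_le_norm _ _))).1
    nlinarith [sq_nonneg ‖v - D.J u + w‖]
  have hyoung : 2 * (‖D.J u‖ * ‖w‖) ≤ C / r * ‖D.J u‖ ^ 2 + (C / r)⁻¹ * ‖w‖ ^ 2 := by
    have := add_sq_le_weighted (x := ‖D.J u‖) (y := ‖w‖) (div_pos hC hr0)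
    nlinarith
  have h1 : (r - C) / (a * d) * (d * b) ≤ (1 - C / r) * ‖D.J u‖ ^ 2 := by
    have h2 : (r - C) / (a * d) * (d * b) = (1 - C / r) * (a⁻¹ * (r * b)) := by field_simp
    have h3 : 0 ≤ 1 - C / r := by
      rw [sub_nonneg, div_le_one hr0]; linarith
    rw [h2, hJ]
    gcongr
  have h4 : (C / r)⁻¹ * ‖w‖ ^ 2 ≤ (r - C) / (a * d) * (ζ₀ * Y) := by
    calc (C / r)⁻¹ * ‖w‖ ^ 2 ≤ (C / r)⁻¹ * (M * Y) := by gcongr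
      _ = (2 * M) * (r / 2 / C * Y) := by field_simp
      _ ≤ C * ζ₀ / (a * d) * (r / 2 / C * Y) := by gcongr
      _ = (r / 2) / (a * d) * (ζ₀ * Y) := by field_simp
      _ ≤ _ := by gcongr; linarith
  have h5 : (r - C) / (a * d) * (∑ k, ζ k * ‖c k‖ ^ 2) ≤ (r - C) / (a * d) * (-ζ₀ * Y) := by
    refine mul_le_mul_of_nonneg_left hζY (div_nonneg (by linarith) (by positivity))
  rw [hform, mul_add]
  nlinarith

/-- The characteristic values of an operator with a self-similar form are asymptotic to `Z`
geometric progressions, `Z` being the number of positive weights. -/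
theorem exists_enumeration_charValues [CompleteSpace H]
    (D : SimilarityDecomposition K ζ a d) (hK : IsCompactOperator K)
    (hS : (K : H →ₗ[ℂ] H).IsSymmetric) (hsimple : HasSimpleCharValues K) (ha : 0 < a) (hd : 0 < d)
    (had : a * d < 1) (hζ : ∀ k, ζ k ≠ 0) {Z : ℕ} (hZ : Fintype.card {k // 0 < ζ k} = Z)
    (hZ0 : 0 < Z) :
    ∃ lam : ℕ → ℝ, StrictMonoOn lam (Set.Ici 1) ∧ lam '' Set.Ici 1 = charValues K ∧
      ∃ μ : ℕ → ℝ, ∀ l ∈ Finset.Icc 1 Z, 0 < μ l ∧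
        (fun k : ℕ => lam (l + k * Z)) ~[atTop] (fun k : ℕ => μ l * (a * d) ^ (-(k : ℤ))) := by
  have had0 : 0 < a * d := mul_pos ha hd
  obtain ⟨ζ₀, hζ₀, hζmin⟩ : ∃ ζ₀, 0 < ζ₀ ∧ ∀ k, ζ₀ ≤ |ζ k| := by
    have : Nonempty ι := by
      obtain ⟨k⟩ := Fintype.card_pos_iff.1 (hZ ▸ hZ0)
      exact ⟨k.1⟩
    obtain ⟨k, hk⟩ := Finite.exists_min fun k => |ζ k|
    exact ⟨|ζ k|, abs_pos.2 (hζ k), hk⟩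
  obtain ⟨C, hC, hCM⟩ : ∃ C, 0 < C ∧ 2 * ∑ k, ‖D.h k‖ ^ 2 < C * ζ₀ / (a * d) := by
    have hM0 : 0 ≤ ∑ k, ‖D.h k‖ ^ 2 := Finset.sum_nonneg fun k _ => by positivity
    refine ⟨(2 * ∑ k, ‖D.h k‖ ^ 2 + 1) * (a * d) / ζ₀, by positivity, ?_⟩
    rw [div_mul_cancel₀ _ hζ₀.ne', mul_div_cancel_right₀ _ had0.ne']
    linarith
  have hM0 : 0 ≤ ∑ k, ‖D.h k‖ ^ 2 := Finset.sum_nonneg fun k _ => by positivity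
  obtain ⟨e, he, hKe⟩ := exists_normalized_eigenvectors hS
  refine exists_enumeration_isEquivalent (finite_charValues_inter_Iio hK hS) hZ0 had0 had hC.le
    (fun x hx => hx.1) (fun s r hs hr hsr => ?_) (fun r hr => ?_)
  · -- the form is negative on the copies of the eigenvectors in `s` together with the `h k`, `0 < ζ k`
    let s' : s → charValues K := fun i => ⟨i.1, hs i.2⟩
    have hs' : Function.Injective s' := fun i j hij =>
      Subtype.ext (congrArg (fun x : charValues K => x.1) hij)
    let ext : ({k // 0 < ζ k} → ℂ) →ₗ[ℂ] (ι → ℂ) :=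
      { toFun := fun c k => if h : 0 < ζ k then c ⟨k, h⟩ else 0
        map_add' := fun c c' => by funext k; by_cases h : 0 < ζ k <;> simp [h]
        map_smul' := fun t c => by funext k; by_cases h : 0 < ζ k <;> simp [h] }
    let g : ((s → ℂ) × ({k // 0 < ζ k} → ℂ)) →ₗ[ℂ] H :=
      (D.J ∘ₗ Fintype.linearCombination ℂ fun i => e (s' i)).coprod
        ((Fintype.linearCombination ℂ D.h) ∘ₗ ext)
    have h := finrank_le_ncard_of_neg hK hS hsimple g (r := (r + C) / (a * d)) (by positivity) (by
      rintro ⟨c, c'⟩ hcc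
      have hg : g (c, c') = D.J (∑ i, c i • e (s' i)) + ∑ k, ext c' k • D.h k := by
        simp [g, Fintype.linearCombination_apply]
      rw [hg]
      refine D.form_neg hS ha hd (fun k hk => (hζmin k).trans_eq (abs_of_pos hk)) hC
        (by linarith) hr ?_ (fun k hk => ?_) ?_
      · rw [norm_sq_sum_eigenvectors he hs', reApplyInnerSelf_sum_eigenvectors he hKe hs',
          Finset.mul_sum]
        refine Finset.sum_le_sum fun i _ => ?_
        rw [← mul_assoc]
        refine le_mul_of_one_le_left (by positivity) ?_
        rw [← div_eq_mul_inv, one_le_div (hs i.2).1]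
        exact hsr _ i.2
      · by_contra h
        exact hk (dif_neg h)
      · by_contra! h
        refine hcc (Prod.ext ?_ ?_)
        · have h1 := norm_sq_sum_eigenvectors he hs' c
          rw [h.1, norm_zero, zero_pow two_ne_zero, eq_comm,
            Finset.sum_eq_zero_iff_of_nonneg (fun k _ => by positivity)] at h1
          funext i
          simpa using h1 i (Finset.mem_univ i)
        · funext k
          have := congrFun h.2 k.1
          simpa [ext, k.2] using this)
    rw [Module.finrank_prod, Module.finrank_fintype_fun_eq_card, Module.finrank_fintype_fun_eq_card,
      hZ, Fintype.card_coe] at h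
    exact h
  · -- the form is nonnegative where the `ev k`, `0 < ζ k`, and the eigenvector coefficients of the
    -- rescaled part vanish
    have hfin := finite_charValues_inter_Iio hK hS r
    have : Fintype ↥(charValues K ∩ Set.Iio r) := hfin.fintype
    let f : H →ₗ[ℂ] (↥(charValues K ∩ Set.Iio r) → ℂ) :=
      LinearMap.pi fun i => (innerSL ℂ (e ⟨i.1, i.2.1⟩) : H →ₗ[ℂ] ℂ)
    let P : H →ₗ[ℂ] H := LinearMap.id - ∑ k, (D.ev k).smulRight (D.h k)
    have hP : ∀ y, P y = y - ∑ k, D.ev k y • D.h k := fun y => by simp [P]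
    let f' : H →ₗ[ℂ] (↥(charValues K ∩ Set.Iio r) → ℂ) × ({k // 0 < ζ k} → ℂ) :=
      (f ∘ₗ D.R ∘ₗ P).prod (LinearMap.pi fun k => D.ev k.1)
    have h := ncard_le_finrank_of_nonneg hK hS f' (r := (r - C) / (a * d)) (by
      intro y hy
      have hy1 : f (D.R (P y)) = 0 := congrArg Prod.fst hy
      have hy2 : ∀ k, 0 < ζ k → D.ev k y = 0 := fun k hk =>
        congrFun (congrArg Prod.snd hy) ⟨k, hk⟩
      rw [hP] at hy1
      refine D.form_nonneg hS ha hd (fun k hk => ?_) hζ₀ hC hCM hr hy2 ?_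
      · have := hζmin k
        rw [abs_of_nonpos hk] at this
        linarith
      · refine mul_reApplyInnerSelf_le_of_inner_eq_zero hK hS hsimple he hKe (by linarith)
          fun i hi => ?_
        exact congrFun hy1 ⟨i.1, i.2, hi⟩)
    rw [Module.finrank_prod, Module.finrank_fintype_fun_eq_card, Module.finrank_fintype_fun_eq_card,
      hZ, ← Nat.card_eq_fintype_card, Nat.card_coe_set_eq] at h
    exact h

end SimilarityDecomposition

end Decomposition

/-! ### Absolutely continuous complex-valued functions -/

theorem absolutelyContinuousOnInterval_ofReal {f : ℝ → ℝ} {a b : ℝ}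
    (hf : AbsolutelyContinuousOnInterval f a b) :
    AbsolutelyContinuousOnInterval (fun x => (f x : ℂ)) a b := by
  simpa [AbsolutelyContinuousOnInterval, Complex.isometry_ofReal.dist_eq] using hf

theorem absolutelyContinuousOnInterval_conj {f : ℝ → ℂ} {a b : ℝ}
    (hf : AbsolutelyContinuousOnInterval f a b) :
    AbsolutelyContinuousOnInterval (fun x => conj (f x)) a b := by
  simpa [AbsolutelyContinuousOnInterval, Complex.dist_conj_conj] using hf

theorem absolutelyContinuousOnInterval_integral {g : ℝ → ℂ} (hg : Integrable g) (a b : ℝ) :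
    AbsolutelyContinuousOnInterval (fun x => ∫ t in a..x, g t) a b := by
  have h1 := (hg.re.intervalIntegrable (a := a) (b := b)
    ).absolutelyContinuousOnInterval_intervalIntegral (Set.left_mem_uIcc)
  have h2 := (hg.im.intervalIntegrable (a := a) (b := b)
    ).absolutelyContinuousOnInterval_intervalIntegral (Set.left_mem_uIcc)
  have h3 := (absolutelyContinuousOnInterval_ofReal h1).add
    ((absolutelyContinuousOnInterval_ofReal h2).const_smul Complex.I)
  refine Eq.subst (motive := fun f => AbsolutelyContinuousOnInterval f a b) ?_ h3
  funext x
  simp only [Pi.add_apply, smul_eq_mul]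
  have h4 := intervalIntegral.intervalIntegral_re (hg.intervalIntegrable (a := a) (b := x))
  have h5 := intervalIntegral.intervalIntegral_im (hg.intervalIntegrable (a := a) (b := x))
  rw [h4, h5, mul_comm]
  exact Complex.re_add_im _

theorem ae_hasDerivAt_of_absolutelyContinuousOnInterval {f : ℝ → ℂ} {a b : ℝ}
    (hf : AbsolutelyContinuousOnInterval f a b) :
    ∀ᵐ x, x ∈ Set.uIcc a b → HasDerivAt f (deriv f x) x := by
  filter_upwards [hf.boundedVariationOn.ae_differentiableAt_of_mem_uIcc] with x hx hxab
  exact (hx hxab).hasDerivAt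

/-- The fundamental theorem of calculus for complex-valued absolutely continuous functions. -/
theorem integral_eq_sub_of_absolutelyContinuousOnInterval {f g : ℝ → ℂ} {a b : ℝ}
    (hf : AbsolutelyContinuousOnInterval f a b) (hg : Integrable g)
    (hfg : ∀ᵐ x, x ∈ Set.uIcc a b → HasDerivAt f (g x) x) :
    ∫ x in a..b, g x = f b - f a := by
  have h0 : AbsolutelyContinuousOnInterval (f - fun x => ∫ t in a..x, g t) a b :=
    hf.sub (absolutelyContinuousOnInterval_integral hg a b)
  obtain ⟨C, hC⟩ := h0.const_of_ae_hasDerivAt_zero (by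
    filter_upwards [hfg,
      LocallyIntegrable.ae_hasDerivAt_integral hg.locallyIntegrable] with x h1 h2 h3
    simpa using (h1 h3).sub (h2 a))
  have ha := hC a Set.left_mem_uIcc
  have hb := hC b Set.right_mem_uIcc
  simp only [Pi.sub_apply, intervalIntegral.integral_same, sub_zero] at ha hb
  rw [ha, ← hb]; ring

/-- `y` is a primitive on `ℝ` of the function `g`, which is in `L₁(ℝ)` and in `L₂(ℝ)`. -/
structure IsPrimitive (y g : ℝ → ℂ) : Prop where
  integrable : Integrable g
  memLp : MemLp g 2
  ftc : ∀ a b, ∫ x in a..b, g x = y b - y a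

namespace IsPrimitive

variable {y z g h : ℝ → ℂ}

theorem eq_add_integral (hy : IsPrimitive y g) (a : ℝ) :
    y = fun x => y a + ∫ t in a..x, g t := by
  funext x; rw [hy.ftc]; ring

theorem ae_hasDerivAt (hy : IsPrimitive y g) : ∀ᵐ x, HasDerivAt y (g x) x := by
  filter_upwards [LocallyIntegrable.ae_hasDerivAt_integral hy.integrable.locallyIntegrable] with x hx
  rw [hy.eq_add_integral 0]
  exact (hx 0).const_add _

theorem ae_deriv_eq (hy : IsPrimitive y g) : ∀ᵐ x, deriv y x = g x := by
  filter_upwards [hy.ae_hasDerivAt] with x hx using hx.deriv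

theorem absolutelyContinuousOnInterval (hy : IsPrimitive y g) (a b : ℝ) :
    AbsolutelyContinuousOnInterval y a b := by
  have h := absolutelyContinuousOnInterval_integral hy.integrable a b
  rw [hy.eq_add_integral a]
  simpa [AbsolutelyContinuousOnInterval] using h

theorem continuous (hy : IsPrimitive y g) : Continuous y := by
  rw [hy.eq_add_integral 0]
  exact continuous_const.add (intervalIntegral.continuous_primitive
    (fun a b => hy.integrable.intervalIntegrable) 0)

theorem memH (hy : IsPrimitive y g) (h0 : ∀ x, x ∉ Set.Ioo (0 : ℝ) 1 → y x = 0) : MemH y where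
  ac := hy.absolutelyContinuousOnInterval 0 1
  deriv_memLp := (hy.memLp.restrict _).ae_eq (ae_restrict_of_ae (by
    filter_upwards [hy.ae_deriv_eq] with x hx using hx.symm))
  zero_off := h0

end IsPrimitive

theorem quasiMeasurePreserving_mul_add {s : ℝ} (hs : s ≠ 0) (t : ℝ) :
    Measure.QuasiMeasurePreserving (fun x : ℝ => s * x + t) volume volume := by
  have h1 : Measure.QuasiMeasurePreserving (fun x : ℝ => s * x) volume volume := by
    refine ⟨measurable_const_mul s, ?_⟩
    rw [Real.map_volume_mul_left hs]
    exact Measure.smul_absolutelyContinuous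
  exact (measurePreserving_add_right volume t).quasiMeasurePreserving.comp h1

theorem ae_comp_mul_add {s : ℝ} (hs : s ≠ 0) (t : ℝ) {p : ℝ → Prop} (hp : ∀ᵐ x, p x) :
    ∀ᵐ x, p (s * x + t) :=
  (quasiMeasurePreserving_mul_add hs t).ae hp

theorem memLp_two_comp_mul_add {g : ℝ → ℂ} (hg : MemLp g 2) {s : ℝ} (hs : s ≠ 0) (t : ℝ) :
    MemLp (fun x => g (s * x + t)) 2 := by
  refine (memLp_two_iff_integrable_sq_norm
    (hg.1.comp_quasiMeasurePreserving (quasiMeasurePreserving_mul_add hs t))).2 ?_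
  exact (((memLp_two_iff_integrable_sq_norm hg.1).1 hg).comp_add_right t).comp_mul_left' hs

theorem IsPrimitive.comp_mul_add {y g : ℝ → ℂ} (hy : IsPrimitive y g) {s : ℝ} (hs : s ≠ 0)
    (t : ℝ) : IsPrimitive (fun x => y (s * x + t)) (fun x => (s : ℂ) • g (s * x + t)) where
  integrable := ((hy.integrable.comp_add_right t).comp_mul_left' hs).smul (s : ℂ)
  memLp := (memLp_two_comp_mul_add hy.memLp hs t).const_smul (s : ℂ)
  ftc a b := by
    rw [intervalIntegral.integral_smul, intervalIntegral.integral_comp_mul_add g hs, hy.ftc,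
      Complex.real_smul, smul_eq_mul, ← mul_assoc, ← Complex.ofReal_mul, mul_inv_cancel₀ hs]
    simp

/-- The fundamental theorem of calculus on `ℝ` for functions supported in `[α, β]`. -/
theorem integral_eq_sub_of_support {y g : ℝ → ℂ} {α β : ℝ} (hαβ : α ≤ β) (hg : Integrable g)
    (hg0 : ∀ x, x ∉ Set.Icc α β → g x = 0) (hy0 : ∀ x, x ∉ Set.Ioo α β → y x = 0)
    (hy : ∀ x ∈ Set.Icc α β, ∫ t in α..x, g t = y x) (a b : ℝ) :
    ∫ x in a..b, g x = y b - y a := by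
  have hG : ∀ x, ∫ t in α..x, g t = y x := by
    intro x
    by_cases hx : x ∈ Set.Icc α β
    · exact hy x hx
    · rw [hy0 x fun h => hx (Set.Ioo_subset_Icc_self h)]
      rw [Set.mem_Icc, not_and_or, not_le, not_le] at hx
      rcases hx with hx | hx
      · refine intervalIntegral.integral_zero_ae ?_
        filter_upwards [compl_mem_ae_iff.2 (measure_singleton α)] with t ht htx
        rw [Set.uIoc_of_ge hx.le] at htx
        exact hg0 t fun h => ht (le_antisymm htx.2 h.1)
      · rw [← intervalIntegral.integral_add_adjacent_intervals (b := β) hg.intervalIntegrable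
          hg.intervalIntegrable, hy β (Set.right_mem_Icc.2 hαβ), hy0 β fun h => lt_irrefl _ h.2, zero_add]
        refine intervalIntegral.integral_zero_ae (Eventually.of_forall fun t htx => ?_)
        rw [Set.uIoc_of_le hx.le] at htx
        exact hg0 t fun h => absurd htx.1 (not_lt.2 h.2)
  rw [← hG a, ← hG b, intervalIntegral.integral_interval_sub_left hg.intervalIntegrable
    hg.intervalIntegrable]

theorem IsPrimitive.indicator {y g : ℝ → ℂ} (hy : IsPrimitive y g) {α β : ℝ} (hαβ : α ≤ β)
    (hα : y α = 0) (hβ : y β = 0) :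
    IsPrimitive ((Set.Ioo α β).indicator y) ((Set.Ioo α β).indicator g) where
  integrable := hy.integrable.indicator measurableSet_Ioo
  memLp := hy.memLp.indicator measurableSet_Ioo
  ftc := by
    refine integral_eq_sub_of_support hαβ (hy.integrable.indicator measurableSet_Ioo)
      (fun x hx => Set.indicator_of_notMem (fun h => hx (Set.Ioo_subset_Icc_self h)) _)
      (fun x hx => Set.indicator_of_notMem hx _) fun x (hx : α ≤ x ∧ x ≤ β) => ?_
    have h1 : ∫ t in α..x, (Set.Ioo α β).indicator g t = ∫ t in α..x, g t := by
      refine intervalIntegral.integral_congr_ae ?_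
      filter_upwards [compl_mem_ae_iff.2 (measure_singleton β)] with t ht htx
      rw [Set.uIoc_of_le hx.1] at htx
      exact Set.indicator_of_mem (Set.mem_Ioo.2 ⟨htx.1, lt_of_le_of_ne (htx.2.trans hx.2) ht⟩) _
    rw [h1, hy.ftc, hα, sub_zero]
    by_cases hx' : x ∈ Set.Ioo α β
    · rw [Set.indicator_of_mem hx']
    · rw [Set.indicator_of_notMem hx']
      rcases hx.1.eq_or_lt with rfl | h
      · exact hα
      · have : x = β := by
          by_contra hne
          exact hx' ⟨h, lt_of_le_of_ne hx.2 hne⟩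
        rw [this, hβ]

/-! ### The space `W̊₂¹[0,1]` -/

namespace MemH

variable {y z : ℝ → ℂ}

theorem deriv_eq_zero (hy : MemH y) {x : ℝ} (hx : x ∉ Set.Icc (0 : ℝ) 1) : deriv y x = 0 := by
  have h : y =ᶠ[𝓝 x] fun _ => 0 := by
    filter_upwards [isClosed_Icc.isOpen_compl.mem_nhds hx] with t ht
    exact hy.zero_off t fun h => ht (Set.Ioo_subset_Icc_self h)
  rw [h.deriv_eq, deriv_const]

theorem indicator_deriv (hy : MemH y) : (Set.Icc (0 : ℝ) 1).indicator (deriv y) = deriv y :=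
  Set.indicator_eq_self.2 fun _ hx => by_contra fun h => hx (hy.deriv_eq_zero h)

theorem isPrimitive (hy : MemH y) : IsPrimitive y (deriv y) := by
  have hint : Integrable (deriv y) := by
    rw [← hy.indicator_deriv, integrable_indicator_iff measurableSet_Icc]
    exact hy.deriv_memLp.integrable one_le_two
  refine ⟨hint, ?_, ?_⟩
  · rw [← hy.indicator_deriv, memLp_indicator_iff_restrict measurableSet_Icc]
    exact hy.deriv_memLp
  · refine integral_eq_sub_of_support zero_le_one hint (fun x hx => hy.deriv_eq_zero hx)
      hy.zero_off fun x hx => ?_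
    have hac : AbsolutelyContinuousOnInterval y 0 x := hy.ac.mono (by
      rw [Set.uIcc_of_le hx.1, Set.uIcc_of_le zero_le_one]
      exact Set.Icc_subset_Icc_right hx.2)
    rw [integral_eq_sub_of_absolutelyContinuousOnInterval hac hint
      (ae_hasDerivAt_of_absolutelyContinuousOnInterval hac), hy.zero_off 0 (by simp), sub_zero]

theorem continuous (hy : MemH y) : Continuous y := hy.isPrimitive.continuous

theorem ae_hasDerivAt (hy : MemH y) : ∀ᵐ x, HasDerivAt y (deriv y x) x :=
  hy.isPrimitive.ae_hasDerivAt

theorem integral_deriv (hy : MemH y) (a b : ℝ) : ∫ x in a..b, deriv y x = y b - y a :=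
  hy.isPrimitive.ftc a b

theorem exists_bound (hy : MemH y) : ∃ C, ∀ x, ‖y x‖ ≤ C := by
  obtain ⟨C, hC⟩ := isCompact_Icc.exists_bound_of_continuousOn
    (hy.continuous.continuousOn (s := Set.Icc (0 : ℝ) 1))
  refine ⟨max C 0, fun x => ?_⟩
  by_cases hx : x ∈ Set.Icc (0 : ℝ) 1
  · exact (hC x hx).trans (le_max_left _ _)
  · rw [hy.zero_off x fun h => hx (Set.Ioo_subset_Icc_self h), norm_zero]
    exact le_max_right _ _

theorem ae_hasDerivAt_mul_conj (hy : MemH y) (hz : MemH z) :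
    ∀ᵐ x, HasDerivAt (fun t => y t * conj (z t))
      (deriv y x * conj (z x) + y x * conj (deriv z x)) x := by
  filter_upwards [hy.ae_hasDerivAt, hz.ae_hasDerivAt] with x h1 h2
  exact h1.mul h2.star

theorem mul_conj (hy : MemH y) (hz : MemH z) : MemH (fun t => y t * conj (z t)) where
  ac := hy.ac.fun_smul (absolutelyContinuousOnInterval_conj hz.ac)
  deriv_memLp := by
    obtain ⟨Cy, hCy⟩ := hy.exists_bound
    obtain ⟨Cz, hCz⟩ := hz.exists_bound
    have h1 : MemLp (fun x => deriv y x * conj (z x)) 2 (volume.restrict (Set.Icc (0 : ℝ) 1)) :=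
      hy.deriv_memLp.of_le_mul (c := Cz) (hy.deriv_memLp.1.mul
        (Complex.continuous_conj.comp hz.continuous).aestronglyMeasurable)
        (Eventually.of_forall fun x => by
          rw [norm_mul, RCLike.norm_conj, mul_comm]
          exact mul_le_mul_of_nonneg_right (hCz x) (norm_nonneg _))
    have h2 : MemLp (fun x => y x * conj (deriv z x)) 2 (volume.restrict (Set.Icc (0 : ℝ) 1)) :=
      hz.deriv_memLp.of_le_mul (c := Cy) (hy.continuous.aestronglyMeasurable.mul
        (Complex.continuous_conj.comp_aestronglyMeasurable hz.deriv_memLp.1))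
        (Eventually.of_forall fun x => by
          rw [norm_mul, RCLike.norm_conj]
          exact mul_le_mul_of_nonneg_right (hCy x) (norm_nonneg _))
    refine (h1.add h2).ae_eq (ae_restrict_of_ae ?_)
    filter_upwards [hy.ae_hasDerivAt_mul_conj hz] with x hx using hx.deriv.symm
  zero_off x hx := by rw [hy.zero_off x hx, zero_mul]

/-- The restriction of a function to `(α, β)` is carried to `(0, 1)` by an affine map. -/
theorem rescale (hy : MemH y) {s t : ℝ} (hs : 0 < s) (h0 : y t = 0) (h1 : y (s + t) = 0) :
    MemH ((Set.Ioo (0 : ℝ) 1).indicator fun x => y (s * x + t)) :=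
  ((hy.isPrimitive.comp_mul_add hs.ne' t).indicator zero_le_one (by simpa using h0)
    (by simpa using h1)).memH fun _ hx => Set.indicator_of_notMem hx _

/-- The copy of a function on `(0, 1)` carried to the interval `(t, s + t) ⊆ (0, 1)`. -/
theorem insert (hy : MemH y) {s t : ℝ} (hs : 0 < s) (ht : 0 ≤ t) (hst : s + t ≤ 1) :
    MemH (fun x => y (s⁻¹ * x + -(s⁻¹ * t))) := by
  refine (hy.isPrimitive.comp_mul_add (inv_pos.2 hs).ne' _).memH fun x hx =>
    hy.zero_off _ fun h => hx ?_
  have h1 : s⁻¹ * x + -(s⁻¹ * t) = (x - t) / s := by field_simp; ring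
  rw [h1] at h
  have h2 := (lt_div_iff₀ hs).1 h.1
  have h3 := (div_lt_iff₀ hs).1 h.2
  constructor <;> linarith

end MemH

/-! ### The Hilbert space of derivatives and the operator of the string -/

/-- The complex space `L₂[0,1]`. -/
abbrev UnitL2 : Type := Lp ℂ 2 (volume.restrict (Set.Icc (0 : ℝ) 1))

/-- The indicator function of `s ∩ [0,1]` as an element of `L₂[0,1]`. -/
noncomputable def indicatorVec {s : Set ℝ} (hs : MeasurableSet s) : UnitL2 :=
  indicatorConstLp 2 hs (measure_ne_top _ s) 1

/-- The space `W̊₂¹[0,1]`, an element `y` being represented by its derivative: the functions in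
`L₂[0,1]` with integral zero. The inner product is `∫ y' z̄'`, antilinear in the first factor. -/
noncomputable def energySpace : Submodule ℂ UnitL2 :=
  (ℂ ∙ indicatorVec MeasurableSet.univ)ᗮ

noncomputable instance : CompleteSpace energySpace :=
  inferInstanceAs (CompleteSpace (ℂ ∙ indicatorVec MeasurableSet.univ)ᗮ)

/-- The inner product of `energySpace` as a subspace of `L₂[0,1]`; the shortcut keeps instance
search from finding it through Hilbert `C⋆`-modules. -/
noncomputable instance : Inner ℂ energySpace := InnerProductSpace.toInner

/-- The primitive `∫₀ˣ g` of a function given on `[0,1]` and extended by zero. -/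
noncomputable def prim (g : UnitL2) (x : ℝ) : ℂ :=
  ∫ t in Set.Iic x, g t ∂(volume.restrict (Set.Icc (0 : ℝ) 1))

theorem inner_indicatorVec {s : Set ℝ} (hs : MeasurableSet s) (g : UnitL2) :
    inner ℂ (indicatorVec hs) g = ∫ t in s, g t ∂(volume.restrict (Set.Icc (0 : ℝ) 1)) :=
  L2.inner_indicatorConstLp_one hs _ g

theorem mem_energySpace_iff {g : UnitL2} : g ∈ energySpace ↔ ∫ t in Set.Icc (0 : ℝ) 1, g t = 0 := by
  rw [energySpace, Submodule.mem_orthogonal_singleton_iff_inner_right, inner_indicatorVec,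
    Measure.restrict_univ]

theorem integrable_unitL2 (g : UnitL2) : Integrable g (volume.restrict (Set.Icc (0 : ℝ) 1)) :=
  (Lp.memLp g).integrable one_le_two

theorem prim_eq_inner (g : UnitL2) (x : ℝ) :
    prim g x = inner ℂ (indicatorVec (measurableSet_Iic (a := x))) g :=
  (inner_indicatorVec _ g).symm

theorem prim_add (g h : UnitL2) : prim (g + h) = prim g + prim h := by
  funext x
  simp only [prim_eq_inner, inner_add_right, Pi.add_apply]

theorem prim_smul (c : ℂ) (g : UnitL2) : prim (c • g) = c • prim g := by
  funext x
  simp only [prim_eq_inner, inner_smul_right, Pi.smul_apply, smul_eq_mul]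

theorem isPrimitive_prim (g : UnitL2) :
    IsPrimitive (prim g) ((Set.Icc (0 : ℝ) 1).indicator g) where
  integrable := (integrable_indicator_iff measurableSet_Icc).2 (integrable_unitL2 g)
  memLp := (memLp_indicator_iff_restrict measurableSet_Icc).2 (Lp.memLp g)
  ftc a b := by
    have hi : Integrable ((Set.Icc (0 : ℝ) 1).indicator g) :=
      (integrable_indicator_iff measurableSet_Icc).2 (integrable_unitL2 g)
    have h : ∀ x, prim g x = ∫ t in Set.Iic x, (Set.Icc (0 : ℝ) 1).indicator g t := fun x => by
      rw [prim, Measure.restrict_restrict measurableSet_Iic, setIntegral_indicator measurableSet_Icc]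
    rw [h, h, intervalIntegral.integral_Iic_sub_Iic hi.integrableOn hi.integrableOn]

theorem memH_prim {g : UnitL2} (hg : g ∈ energySpace) : MemH (prim g) := by
  refine (isPrimitive_prim g).memH fun x hx => ?_
  rw [Set.mem_Ioo, not_and_or, not_lt, not_lt] at hx
  rcases hx with hx | hx
  · rw [prim, Measure.restrict_restrict measurableSet_Iic]
    refine setIntegral_measure_zero _ (measure_mono_null ?_ (measure_singleton (0 : ℝ)))
    exact fun t ht => le_antisymm (ht.1.trans hx) ht.2.1
  · rw [prim, Measure.restrict_restrict measurableSet_Iic, Set.inter_eq_right.2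
      (fun t ht => ht.2.trans hx), mem_energySpace_iff.1 hg]

theorem ae_deriv_prim (g : UnitL2) :
    ∀ᵐ x ∂(volume.restrict (Set.Icc (0 : ℝ) 1)), deriv (prim g) x = g x := by
  rw [ae_restrict_iff' measurableSet_Icc]
  filter_upwards [(isPrimitive_prim g).ae_deriv_eq] with x hx hx'
  rw [hx, Set.indicator_of_mem hx']

theorem prim_injective : Function.Injective prim := fun g h hgh => by
  refine Lp.ext ?_
  filter_upwards [ae_deriv_prim g, ae_deriv_prim h] with x h1 h2
  rw [← h1, ← h2, hgh]

/-- The element of `energySpace` that corresponds to a function in `W̊₂¹[0,1]`. -/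
noncomputable def ofMemH {y : ℝ → ℂ} (hy : MemH y) : energySpace :=
  ⟨hy.deriv_memLp.toLp, mem_energySpace_iff.2 (by
    rw [integral_congr_ae hy.deriv_memLp.coeFn_toLp, integral_Icc_eq_integral_Ioc,
      ← intervalIntegral.integral_of_le zero_le_one, hy.integral_deriv, hy.zero_off 0 (by simp),
      hy.zero_off 1 (by simp), sub_zero])⟩

theorem prim_ofMemH {y : ℝ → ℂ} (hy : MemH y) : prim (ofMemH hy : UnitL2) = y := by
  funext x
  have h1 := (isPrimitive_prim (ofMemH hy : UnitL2)).ftc 0 x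
  rw [(memH_prim (ofMemH hy).2).zero_off 0 (by simp), sub_zero] at h1
  rw [← h1, ← sub_zero (y x), ← hy.zero_off 0 (by simp), ← hy.integral_deriv 0 x]
  refine intervalIntegral.integral_congr_ae_restrict (ae_restrict_of_ae ?_)
  have h2 := (ae_restrict_iff' measurableSet_Icc).1 hy.deriv_memLp.coeFn_toLp
  filter_upwards [h2] with t ht
  by_cases htm : t ∈ Set.Icc (0 : ℝ) 1
  · rw [Set.indicator_of_mem htm]
    exact ht htm
  · rw [Set.indicator_of_notMem htm, hy.deriv_eq_zero htm]

theorem inner_energySpace (g h : UnitL2) :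
    inner ℂ g h = ∫ x in (0 : ℝ)..1, conj (deriv (prim g) x) * deriv (prim h) x := by
  rw [L2.inner_def, intervalIntegral.integral_of_le zero_le_one, ← integral_Icc_eq_integral_Ioc]
  refine integral_congr_ae ?_
  filter_upwards [ae_deriv_prim g, ae_deriv_prim h] with x h1 h2
  rw [h1, h2, RCLike.inner_apply, mul_comm]

theorem norm_indicatorVec_Ioc_le {s t : ℝ} (hst : s ≤ t) :
    ‖indicatorVec (measurableSet_Ioc (a := s) (b := t))‖ ≤ √(t - s) := by
  rw [indicatorVec, norm_indicatorConstLp two_ne_zero ENNReal.ofNat_ne_top, norm_one, one_mul,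
    Real.sqrt_eq_rpow]
  simp only [ENNReal.toReal_ofNat]
  refine Real.rpow_le_rpow measureReal_nonneg ?_ (by norm_num)
  calc (volume.restrict (Set.Icc (0 : ℝ) 1)).real (Set.Ioc s t) ≤ volume.real (Set.Ioc s t) :=
        ENNReal.toReal_mono (by simp) (Measure.restrict_apply_le _ _)
    _ = t - s := by rw [Real.volume_real_Ioc_of_le hst]

theorem norm_prim_sub_le (g : UnitL2) {s t : ℝ} (hst : s ≤ t) :
    ‖prim g t - prim g s‖ ≤ √(t - s) * ‖g‖ := by
  have h : prim g t - prim g s = inner ℂ (indicatorVec (measurableSet_Ioc (a := s) (b := t))) g := by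
    rw [inner_indicatorVec, prim, prim, intervalIntegral.integral_Iic_sub_Iic
      (integrable_unitL2 g).integrableOn (integrable_unitL2 g).integrableOn,
      intervalIntegral.integral_of_le hst]
  rw [h]
  exact (norm_inner_le_norm _ _).trans
    (mul_le_mul_of_nonneg_right (norm_indicatorVec_Ioc_le hst) (norm_nonneg _))

theorem norm_prim_le (g : UnitL2) {x : ℝ} (hx : x ∈ Set.Icc (0 : ℝ) 1) : ‖prim g x‖ ≤ ‖g‖ := by
  have h0 : prim g 0 = 0 := by
    rw [prim, Measure.restrict_restrict measurableSet_Iic]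
    refine setIntegral_measure_zero _ (measure_mono_null ?_ (measure_singleton (0 : ℝ)))
    exact fun t ht => le_antisymm ht.1 ht.2.1
  have h := norm_prim_sub_le g hx.1
  rw [h0, sub_zero, sub_zero] at h
  refine h.trans (mul_le_of_le_one_left (norm_nonneg _) ?_)
  exact Real.sqrt_le_one.2 hx.2

theorem memLp_mul_prim (p g : UnitL2) :
    MemLp (fun x => p x * prim g x) 2 (volume.restrict (Set.Icc (0 : ℝ) 1)) := by
  refine (Lp.memLp p).of_le_mul (c := ‖g‖) ((Lp.memLp p).1.mul
    (isPrimitive_prim g).continuous.aestronglyMeasurable) ?_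
  filter_upwards [ae_restrict_mem measurableSet_Icc] with x hx
  rw [norm_mul, mul_comm]
  exact mul_le_mul_of_nonneg_right (norm_prim_le g hx) (norm_nonneg _)

/-- The Volterra operator followed by multiplication by `p`: `g ↦ p(x) ∫₀ˣ g`. -/
noncomputable def mulPrim (p : UnitL2) : UnitL2 →L[ℂ] UnitL2 :=
  LinearMap.mkContinuous
    { toFun := fun g => (memLp_mul_prim p g).toLp
      map_add' := fun g h => by
        rw [← MemLp.toLp_add]
        refine MemLp.toLp_congr _ _ (Eventually.of_forall fun x => ?_)
        simp only [prim_add, Pi.add_apply, mul_add]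
      map_smul' := fun c g => by
        rw [RingHom.id_apply, ← MemLp.toLp_const_smul]
        refine MemLp.toLp_congr _ _ (Eventually.of_forall fun x => ?_)
        simp only [prim_smul, Pi.smul_apply, smul_eq_mul, mul_left_comm] }
    ‖p‖ fun g => by
      rw [mul_comm]
      refine Lp.norm_le_mul_norm_of_ae_le_mul ?_
      filter_upwards [(memLp_mul_prim p g).coeFn_toLp, ae_restrict_mem measurableSet_Icc]
        with x h1 hx
      refine (congrArg norm h1).trans_le ?_
      rw [norm_mul, mul_comm]
      exact mul_le_mul_of_nonneg_right (norm_prim_le g hx) (norm_nonneg _)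

theorem coeFn_mulPrim (p g : UnitL2) :
    mulPrim p g =ᵐ[volume.restrict (Set.Icc (0 : ℝ) 1)] fun x => p x * prim g x :=
  (memLp_mul_prim p g).coeFn_toLp

/-- The operator obtained from `mulPrim p` by replacing the primitive by its values at the left
ends of `N` intervals of equal length. -/
noncomputable def mulPrimStep (p : UnitL2) (N : ℕ) : UnitL2 →L[ℂ] UnitL2 :=
  ∑ i ∈ Finset.range N, ContinuousLinearMap.toSpanSingleton ℂ
    (((Lp.memLp p).indicator (measurableSet_Ioc (a := (i / N : ℝ)) (b := ((i + 1 : ℕ) / N : ℝ)))).toLp) ∘L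
      innerSL ℂ (indicatorVec (measurableSet_Iic (a := (i / N : ℝ))))

theorem norm_mulPrim_sub_le (p : UnitL2) {N : ℕ} (hN : 0 < N) :
    ‖mulPrim p - mulPrimStep p N‖ ≤ √(1 / N) * ‖p‖ := by
  have hN' : (0 : ℝ) < N := by exact_mod_cast hN
  refine ContinuousLinearMap.opNorm_le_bound _ (by positivity) fun g => ?_
  rw [mul_right_comm]
  refine Lp.norm_le_mul_norm_of_ae_le_mul ?_
  have hstep : mulPrimStep p N g = ∑ i ∈ Finset.range N, prim g (i / N) •
      ((Lp.memLp p).indicator (measurableSet_Ioc (a := (i / N : ℝ))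
        (b := ((i + 1 : ℕ) / N : ℝ)))).toLp := by
    simp only [mulPrimStep, sum_apply, ContinuousLinearMap.comp_apply,
      innerSL_apply_apply, ContinuousLinearMap.toSpanSingleton_apply, prim_eq_inner]
  have hcoe : ∀ᵐ x ∂(volume.restrict (Set.Icc (0 : ℝ) 1)), mulPrimStep p N g x =
      ∑ i ∈ Finset.range N, prim g (i / N) *
        (Set.Ioc (i / N : ℝ) ((i + 1 : ℕ) / N : ℝ)).indicator p x := by
    rw [hstep]
    have h1 := ae_all_iff.2 fun i : ℕ => ((Lp.memLp p).indicator (measurableSet_Ioc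
      (a := (i / N : ℝ)) (b := ((i + 1 : ℕ) / N : ℝ)))).coeFn_toLp
    have h2 := ae_all_iff.2 fun i : ℕ => Lp.coeFn_smul (prim g (i / N))
      ((Lp.memLp p).indicator (measurableSet_Ioc
      (a := (i / N : ℝ)) (b := ((i + 1 : ℕ) / N : ℝ)))).toLp
    filter_upwards [Lp.coeFn_fun_finsetSum (Finset.range N) fun i : ℕ => prim g (i / N) •
      ((Lp.memLp p).indicator (measurableSet_Ioc (a := (i / N : ℝ))
        (b := ((i + 1 : ℕ) / N : ℝ)))).toLp, h1, h2] with x hx hx1 hx2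
    rw [hx]
    refine Finset.sum_congr rfl fun i _ => ?_
    rw [hx2 i, Pi.smul_apply, hx1 i, smul_eq_mul]
  have h0 : ∀ᵐ x ∂(volume.restrict (Set.Icc (0 : ℝ) 1)), x ≠ 0 :=
    ae_restrict_of_ae (compl_mem_ae_iff.2 (measure_singleton 0))
  filter_upwards [hcoe, coeFn_mulPrim p g, Lp.coeFn_sub (mulPrim p g) (mulPrimStep p N g),
    ae_restrict_mem measurableSet_Icc, h0] with x h1 h2 h3 hx hx0
  rw [sub_apply, h3, Pi.sub_apply, h1, h2]
  have hxpos : 0 < x := lt_of_le_of_ne hx.1 (Ne.symm hx0)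
  -- the interval that contains `x`
  obtain ⟨i, hi⟩ : ∃ i : ℕ, ⌈N * x⌉₊ = i + 1 :=
    Nat.exists_eq_succ_of_ne_zero (Nat.ceil_pos.2 (by positivity)).ne'
  have hxi1 : (i / N : ℝ) < x := by
    rw [div_lt_iff₀ hN', mul_comm]
    exact Nat.lt_ceil.1 (by omega)
  have hxi2 : x ≤ ((i + 1 : ℕ) / N : ℝ) := by
    rw [le_div_iff₀ hN', mul_comm, ← hi]
    exact Nat.le_ceil _
  have hiN : i < N := by
    have : (i : ℝ) < N := by
      have := (div_lt_iff₀ hN').1 (hxi1.trans_le hx.2); linarith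
    exact_mod_cast this
  rw [Finset.sum_eq_single i]
  · rw [Set.indicator_of_mem (Set.mem_Ioc.2 ⟨hxi1, hxi2⟩), mul_comm (p x), ← sub_mul, norm_mul]
    refine mul_le_mul_of_nonneg_right ((norm_prim_sub_le g hxi1.le).trans ?_) (norm_nonneg _)
    refine mul_le_mul_of_nonneg_right (Real.sqrt_le_sqrt ?_) (norm_nonneg _)
    have : ((i + 1 : ℕ) / N : ℝ) = i / N + 1 / N := by push_cast; ring
    linarith
  · intro j _ hji
    refine mul_eq_zero_of_right _ (Set.indicator_of_notMem (fun hj => ?_) _)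
    obtain ⟨hj1, hj2⟩ := Set.mem_Ioc.1 hj
    rw [div_lt_iff₀ hN', mul_comm] at hj1
    rw [le_div_iff₀ hN', mul_comm] at hj2
    have h4 := Nat.lt_ceil.2 hj1
    have h5 := Nat.ceil_le.2 hj2
    omega
  · intro h
    exact absurd (Finset.mem_range.2 hiN) h

theorem tendsto_mulPrimStep (p : UnitL2) : Tendsto (mulPrimStep p) atTop (𝓝 (mulPrim p)) := by
  rw [tendsto_iff_norm_sub_tendsto_zero]
  have h : Tendsto (fun N : ℕ => √(1 / N) * ‖p‖) atTop (𝓝 0) := by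
    have h1 := (Real.continuous_sqrt.tendsto 0).comp (tendsto_one_div_atTop_nhds_zero_nat (𝕜 := ℝ))
    rw [Real.sqrt_zero] at h1
    simpa using h1.mul_const ‖p‖
  refine squeeze_zero' (Eventually.of_forall fun _ => norm_nonneg _) ?_ h
  filter_upwards [eventually_gt_atTop 0] with N hN
  rw [norm_sub_rev]
  exact norm_mulPrim_sub_le p hN

theorem isCompactOperator_comp_of_finiteDimensional {E F : Type*} [NormedAddCommGroup E]
    [NormedSpace ℂ E] [NormedAddCommGroup F] [NormedSpace ℂ F] (u : ℂ →L[ℂ] F) (φ : E →L[ℂ] ℂ) :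
    IsCompactOperator (u ∘L φ) := by
  have h : IsCompactOperator (id : ℂ → ℂ) :=
    (isCompactOperator_id_iff_finiteDimensional (𝕜 := ℂ)).2 inferInstance
  exact (h.clm_comp u).comp_clm φ

theorem isCompactOperator_finset_sum {E F ι : Type*} [NormedAddCommGroup E]
    [NormedSpace ℂ E] [NormedAddCommGroup F] [NormedSpace ℂ F] (s : Finset ι) (T : ι → E →L[ℂ] F)
    (hT : ∀ i ∈ s, IsCompactOperator (T i)) : IsCompactOperator (∑ i ∈ s, T i : E →L[ℂ] F) := by
  have := (compactOperator (RingHom.id ℂ) E F).sum_mem (f := T) (t := s) hT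
  exact this

theorem isCompactOperator_mulPrim (p : UnitL2) : IsCompactOperator (mulPrim p) :=
  isCompactOperator_of_tendsto (tendsto_mulPrimStep p) (Eventually.of_forall fun _ =>
    isCompactOperator_finset_sum _ _ fun _ _ => isCompactOperator_comp_of_finiteDimensional _ _)

theorem isCompactOperator_adjoint_mulPrim (p : UnitL2) :
    IsCompactOperator (ContinuousLinearMap.adjoint (mulPrim p)) := by
  refine isCompactOperator_of_tendsto
    ((ContinuousLinearMap.adjoint.continuous.tendsto _).comp (tendsto_mulPrimStep p))
    (Eventually.of_forall fun N => ?_)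
  simp only [Function.comp_apply, mulPrimStep, map_sum, ContinuousLinearMap.adjoint_comp]
  exact isCompactOperator_finset_sum _ _ fun _ _ =>
    isCompactOperator_comp_of_finiteDimensional _ _

/-- The operator `K` on `W̊₂¹[0,1]` given by `⟪z, K y⟫ = -∫ p (y z̄)'`, for real-valued `p`. -/
noncomputable def stringOperator (p : UnitL2) : energySpace →L[ℂ] energySpace :=
  -(ContinuousLinearMap.adjoint energySpace.subtypeL ∘L
    (mulPrim p + ContinuousLinearMap.adjoint (mulPrim p)) ∘L energySpace.subtypeL)

theorem inner_stringOperator (p : UnitL2) (g h : energySpace) :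
    inner ℂ g (stringOperator p h) =
      -(inner ℂ (g : UnitL2) (mulPrim p h) + inner ℂ (mulPrim p g) (h : UnitL2)) := by
  have : stringOperator p h = -(ContinuousLinearMap.adjoint energySpace.subtypeL
      (mulPrim p h + ContinuousLinearMap.adjoint (mulPrim p) (h : UnitL2))) := rfl
  rw [this, inner_neg_right, ContinuousLinearMap.adjoint_inner_right, inner_add_right]
  congr 2
  exact ContinuousLinearMap.adjoint_inner_right _ _ _

theorem isCompactOperator_stringOperator (p : UnitL2) : IsCompactOperator (stringOperator p) :=
  ((((isCompactOperator_mulPrim p).add (isCompactOperator_adjoint_mulPrim p)).clm_comp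
    (ContinuousLinearMap.adjoint energySpace.subtypeL)).comp_clm energySpace.subtypeL).neg

theorem isSymmetric_stringOperator (p : UnitL2) :
    (stringOperator p : energySpace →ₗ[ℂ] energySpace).IsSymmetric := by
  intro g h
  have h1 := inner_stringOperator p g h
  have h2 := inner_stringOperator p h g
  have h3 : inner ℂ (stringOperator p g) h = conj (inner ℂ h (stringOperator p g)) :=
    (inner_conj_symm _ _).symm
  refine h3.trans ?_
  change _ = inner ℂ g (stringOperator p h)
  rw [h2, h1, map_neg, map_add, inner_conj_symm, inner_conj_symm, add_comm]

/-- The function `P` as an element of the complex `L₂[0,1]`. -/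
noncomputable def toUnitL2 {P : ℝ → ℝ} (hP : MemLp P 2 (volume.restrict (Set.Icc (0 : ℝ) 1))) :
    UnitL2 := (hP.ofReal (K := ℂ)).toLp

/-- The pairing of the generalized derivative `P'` with `p ∈ W̊₂¹[0,1]`. -/
noncomputable def pairing (P : ℝ → ℝ) (p : ℝ → ℂ) : ℂ := -∫ x in (0 : ℝ)..1, (P x : ℂ) * deriv p x

theorem inner_stringOperator_eq_pairing {P : ℝ → ℝ}
    (hP : MemLp P 2 (volume.restrict (Set.Icc (0 : ℝ) 1))) (g h : energySpace) :
    inner ℂ g (stringOperator (toUnitL2 hP) h) =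
      pairing P (fun t => prim (h : UnitL2) t * conj (prim (g : UnitL2) t)) := by
  rw [inner_stringOperator, pairing, L2.inner_def, L2.inner_def,
    ← integral_add (L2.integrable_inner _ _) (L2.integrable_inner _ _),
    intervalIntegral.integral_of_le zero_le_one, ← integral_Icc_eq_integral_Ioc]
  congr 1
  refine integral_congr_ae ?_
  filter_upwards [coeFn_mulPrim (toUnitL2 hP) h, coeFn_mulPrim (toUnitL2 hP) g,
    ae_deriv_prim (g : UnitL2), ae_deriv_prim (h : UnitL2), (hP.ofReal (K := ℂ)).coeFn_toLp,
    ae_restrict_of_ae ((memH_prim h.2).ae_hasDerivAt_mul_conj (memH_prim g.2))]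
    with x h1 h2 h3 h4 h5 h6
  have h7 : (toUnitL2 hP) x = (P x : ℂ) := h5
  rw [h6.deriv, h1, h2, h7, ← h3, ← h4]
  simp only [RCLike.inner_apply, map_mul, Complex.conj_ofReal]
  ring

/-! ### Eigenvalues of the boundary problem and simplicity -/

theorem integrable_mul_unitL2 (p g : UnitL2) :
    Integrable (fun x => p x * g x) (volume.restrict (Set.Icc (0 : ℝ) 1)) :=
  (Lp.memLp p).integrable_mul (Lp.memLp g)

/-- The primitive `∫₀ˣ p g` of a product of two functions given on `[0,1]`. -/
noncomputable def primMul (p g : UnitL2) (x : ℝ) : ℂ :=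
  ∫ t in Set.Iic x, p t * g t ∂(volume.restrict (Set.Icc (0 : ℝ) 1))

theorem primMul_eq_integral (p g : UnitL2) (x : ℝ) :
    primMul p g x = ∫ t in (0 : ℝ)..x, (Set.Icc (0 : ℝ) 1).indicator (fun t => p t * g t) t := by
  have hi : Integrable ((Set.Icc (0 : ℝ) 1).indicator fun t => p t * g t) :=
    (integrable_indicator_iff measurableSet_Icc).2 (integrable_mul_unitL2 p g)
  have h : ∀ x, primMul p g x =
      ∫ t in Set.Iic x, (Set.Icc (0 : ℝ) 1).indicator (fun t => p t * g t) t := fun x => by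
    rw [primMul, Measure.restrict_restrict measurableSet_Iic,
      setIntegral_indicator measurableSet_Icc]
  have h0 : primMul p g 0 = 0 := by
    rw [primMul, Measure.restrict_restrict measurableSet_Iic]
    refine setIntegral_measure_zero _ (measure_mono_null ?_ (measure_singleton (0 : ℝ)))
    exact fun t ht => le_antisymm ht.1 ht.2.1
  rw [← intervalIntegral.integral_Iic_sub_Iic hi.integrableOn hi.integrableOn, ← h, ← h, h0,
    sub_zero]

theorem norm_primMul_le (p g : UnitL2) (x : ℝ) : ‖primMul p g x‖ ≤ ‖p‖ * ‖g‖ := by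
  have hp : MemLp (fun t => conj (p t)) 2 (volume.restrict (Set.Icc (0 : ℝ) 1)) := (Lp.memLp p).star
  have hp' : MemLp ((Set.Iic x).indicator fun t => conj (p t)) 2
      (volume.restrict (Set.Icc (0 : ℝ) 1)) := hp.indicator measurableSet_Iic
  have h : primMul p g x = inner ℂ hp'.toLp g := by
    rw [primMul, L2.inner_def, ← integral_indicator measurableSet_Iic]
    refine integral_congr_ae ?_
    filter_upwards [hp'.coeFn_toLp] with t ht
    rw [ht, RCLike.inner_apply]
    by_cases htx : t ∈ Set.Iic x
    · rw [Set.indicator_of_mem htx, Set.indicator_of_mem htx, Complex.conj_conj, mul_comm]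
    · rw [Set.indicator_of_notMem htx, Set.indicator_of_notMem htx, map_zero, mul_zero]
  rw [h]
  refine (norm_inner_le_norm _ _).trans (mul_le_mul_of_nonneg_right ?_ (norm_nonneg _))
  refine Lp.norm_le_norm_of_ae_le ?_
  filter_upwards [hp'.coeFn_toLp] with t ht
  rw [ht]
  refine (norm_indicator_le_norm_self _ _).trans_eq (RCLike.norm_conj _)

/-- Integration by parts against an element of `W̊₂¹[0,1]`. -/
theorem integral_mul_conj_eq_neg {G z : ℝ → ℂ} (hG : Integrable G) (hz : MemH z) :
    ∫ x in (0 : ℝ)..1, G x * conj (z x) =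
      -∫ x in (0 : ℝ)..1, (∫ t in (0 : ℝ)..x, G t) * conj (deriv z x) := by
  obtain ⟨C, hC⟩ := hz.exists_bound
  have hcont : Continuous fun x => ∫ t in (0 : ℝ)..x, G t :=
    intervalIntegral.continuous_primitive (fun a b => hG.intervalIntegrable) 0
  have h1 : Integrable fun x => G x * conj (z x) :=
    hG.mul_bdd (c := C) (Complex.continuous_conj.comp hz.continuous).aestronglyMeasurable
      (Eventually.of_forall fun x => by rw [RCLike.norm_conj]; exact hC x)
  have h2 : Integrable fun x => (∫ t in (0 : ℝ)..x, G t) * conj (deriv z x) := by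
    have hz' : Integrable fun x => conj (deriv z x) :=
      (Complex.conjCLE : ℂ →L[ℝ] ℂ).integrable_comp hz.isPrimitive.integrable
    refine hz'.bdd_mul (c := ∫ t, ‖G t‖) hcont.aestronglyMeasurable
      (Eventually.of_forall fun x => ?_)
    refine intervalIntegral.norm_integral_le_integral_norm_uIoc.trans ?_
    exact setIntegral_le_integral hG.norm (Eventually.of_forall fun _ => norm_nonneg _)
  have hac := (absolutelyContinuousOnInterval_integral hG 0 1).fun_smul
    (absolutelyContinuousOnInterval_conj hz.ac)
  have h := integral_eq_sub_of_absolutelyContinuousOnInterval hac (h1.add h2) (by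
    filter_upwards [LocallyIntegrable.ae_hasDerivAt_integral hG.locallyIntegrable,
      hz.ae_hasDerivAt] with x hx1 hx2 _
    exact (hx1 0).mul hx2.star)
  simp only [Pi.add_apply] at h
  rw [intervalIntegral.integral_add h1.intervalIntegrable h2.intervalIntegrable,
    hz.zero_off 0 (by simp), hz.zero_off 1 (by simp)] at h
  simp only [map_zero, smul_zero, sub_zero] at h
  exact eq_neg_of_add_eq_zero_left h

/-- A solution satisfies the first-order equation `y' + r P y - r ∫₀ˣ P y' = κ` for the
quasi-derivative, with a constant `κ`. -/
theorem exists_quasiderivative_eq {P : ℝ → ℝ}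
    (hP : MemLp P 2 (volume.restrict (Set.Icc (0 : ℝ) 1))) {r : ℝ} {g : energySpace}
    (hg : g = (r : ℂ) • stringOperator (toUnitL2 hP) g) :
    ∃ κ : ℂ, ∀ᵐ x ∂(volume.restrict (Set.Icc (0 : ℝ) 1)), (g : UnitL2) x =
      κ + r * (primMul (toUnitL2 hP) g x - toUnitL2 hP x * prim (g : UnitL2) x) := by
  set p := toUnitL2 hP with hp
  have hcont : Continuous (primMul p g) := by
    have hi : Integrable ((Set.Icc (0 : ℝ) 1).indicator fun t => p t * (g : UnitL2) t) :=
      (integrable_indicator_iff measurableSet_Icc).2 (integrable_mul_unitL2 p g)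
    rw [funext (primMul_eq_integral p g)]
    exact intervalIntegral.continuous_primitive (fun a b => hi.intervalIntegrable) 0
  have hF : MemLp (primMul p g) 2 (volume.restrict (Set.Icc (0 : ℝ) 1)) :=
    MemLp.of_bound hcont.aestronglyMeasurable (‖p‖ * ‖(g : UnitL2)‖)
      (Eventually.of_forall fun x => norm_primMul_le p g x)
  have horth : ∀ h : energySpace, inner ℂ (mulPrim p h) (g : UnitL2) =
      -inner ℂ (h : UnitL2) hF.toLp := by
    intro h
    have hi : Integrable ((Set.Icc (0 : ℝ) 1).indicator fun t => p t * (g : UnitL2) t) :=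
      (integrable_indicator_iff measurableSet_Icc).2 (integrable_mul_unitL2 p g)
    have h1 := integral_mul_conj_eq_neg hi (memH_prim h.2)
    simp_rw [← primMul_eq_integral] at h1
    rw [intervalIntegral.integral_of_le zero_le_one, intervalIntegral.integral_of_le zero_le_one,
      ← integral_Icc_eq_integral_Ioc, ← integral_Icc_eq_integral_Ioc] at h1
    rw [L2.inner_def, L2.inner_def]
    refine Eq.trans ?_ (h1.trans ?_)
    · refine integral_congr_ae ?_
      filter_upwards [coeFn_mulPrim p h, (hP.ofReal (K := ℂ)).coeFn_toLp,
        ae_restrict_mem measurableSet_Icc] with x hx hx' hxm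
      have hpx : p x = (P x : ℂ) := hx'
      rw [hx, RCLike.inner_apply, Set.indicator_of_mem hxm, map_mul, hpx]
      simp only [Complex.conj_ofReal]
      ring
    · congr 1
      refine integral_congr_ae ?_
      filter_upwards [ae_deriv_prim (h : UnitL2), hF.coeFn_toLp] with x hx hx'
      rw [hx, hx', RCLike.inner_apply]
  have hmem : (g : UnitL2) + (r : ℂ) • (mulPrim p g - hF.toLp) ∈
      (ℂ ∙ indicatorVec MeasurableSet.univ) := by
    rw [← Submodule.orthogonal_orthogonal (ℂ ∙ indicatorVec MeasurableSet.univ),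
      Submodule.mem_orthogonal]
    intro h hh
    have h1 := inner_stringOperator p ⟨h, hh⟩ g
    have h2 : inner ℂ h (g : UnitL2) = r * inner ℂ (⟨h, hh⟩ : energySpace) (stringOperator p g) := by
      rw [← inner_smul_right, ← hg]; rfl
    rw [inner_add_right, inner_smul_right, inner_sub_right, h2, h1, horth ⟨h, hh⟩]
    ring
  obtain ⟨κ, hκ⟩ := Submodule.mem_span_singleton.1 hmem
  refine ⟨κ, ?_⟩
  have hone : ∀ᵐ x ∂(volume.restrict (Set.Icc (0 : ℝ) 1)),
      indicatorVec MeasurableSet.univ x = 1 := by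
    filter_upwards [indicatorConstLp_coeFn (p := 2) (hs := MeasurableSet.univ)
      (hμs := measure_ne_top (volume.restrict (Set.Icc (0 : ℝ) 1)) Set.univ) (c := (1 : ℂ))]
      with x hx
    rw [indicatorVec, hx, Set.indicator_univ]
  filter_upwards [Lp.coeFn_add (g : UnitL2) ((r : ℂ) • (mulPrim p g - hF.toLp)),
    Lp.coeFn_smul (r : ℂ) (mulPrim p g - hF.toLp), Lp.coeFn_sub (mulPrim p g) hF.toLp,
    hF.coeFn_toLp, coeFn_mulPrim p g, Lp.coeFn_smul κ (indicatorVec MeasurableSet.univ), hone]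
    with x h1 h2 h3 h4 h5 h6 h7
  rw [← hκ, h6, Pi.smul_apply, h7, Pi.add_apply, h2, Pi.smul_apply, h3, Pi.sub_apply, h4, h5,
    smul_eq_mul, smul_eq_mul, mul_one] at h1
  rw [h1]; ring

/-- One step of the uniqueness argument: the homogeneous first-order equation propagates zeros
over a distance `δ` with `2 |r| √δ ‖p‖ < 1`, since on an interval of length `δ` the right-hand side
is a contraction in `L₂`. -/
theorem ae_eq_zero_step (p : UnitL2) (g : UnitL2) {r δ c : ℝ} (hδ : 0 ≤ δ)
    (hsmall : 2 * |r| * √δ * ‖p‖ < 1)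
    (hg : ∀ᵐ x ∂(volume.restrict (Set.Icc (0 : ℝ) 1)),
      g x = r * (primMul p g x - p x * prim g x))
    (hc : ∀ᵐ x ∂(volume.restrict (Set.Icc (0 : ℝ) 1)), x ≤ c → g x = 0) :
    ∀ᵐ x ∂(volume.restrict (Set.Icc (0 : ℝ) 1)), x ≤ c + δ → g x = 0 := by
  set μ := volume.restrict (Set.Icc (0 : ℝ) 1)
  have hγm : MemLp ((Set.Ioc c (c + δ)).indicator g) 2 μ := (Lp.memLp g).indicator measurableSet_Ioc
  set γ : UnitL2 := hγm.toLp with hγ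
  have hγc := hγm.coeFn_toLp
  -- up to `c + δ`, the functions `g` and `γ` agree
  have hgγ : ∀ᵐ t ∂μ, t ≤ c + δ → g t = γ t := by
    filter_upwards [hc, hγc] with t h1 h2 ht
    rw [h2]
    by_cases htc : t ≤ c
    · rw [h1 htc, Set.indicator_of_notMem fun h => absurd h.1 (not_lt.2 htc)]
    · rw [Set.indicator_of_mem (Set.mem_Ioc.2 ⟨not_le.1 htc, ht⟩)]
  have hprim : ∀ x ≤ c + δ, prim g x = prim γ x := fun x hx => by
    refine setIntegral_congr_ae measurableSet_Iic ?_
    filter_upwards [hgγ] with t ht htx using ht (le_trans htx hx)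
  have hprimMul : ∀ x ≤ c + δ, primMul p g x = primMul p γ x := fun x hx => by
    refine setIntegral_congr_ae measurableSet_Iic ?_
    filter_upwards [hgγ] with t ht htx
    rw [ht (le_trans htx hx)]
  have hprimc : prim γ c = 0 := by
    rw [prim, setIntegral_congr_ae measurableSet_Iic (g := fun _ => 0), integral_zero]
    filter_upwards [hγc] with t ht htc
    rw [ht, Set.indicator_of_notMem fun h => absurd h.1 (not_lt.2 htc)]
  have hnp : MemLp (fun x => (‖p x‖ : ℂ)) 2 μ := (Lp.memLp p).norm.ofReal
  have hγle : ‖γ‖ ≤ ‖((|r| * (‖p‖ * ‖γ‖) : ℝ) : ℂ) •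
      indicatorVec (measurableSet_Ioc (a := c) (b := c + δ)) +
        ((|r| * (√δ * ‖γ‖) : ℝ) : ℂ) • hnp.toLp‖ := by
    refine Lp.norm_le_norm_of_ae_le ?_
    have hind := indicatorConstLp_coeFn (p := 2) (hs := measurableSet_Ioc (a := c) (b := c + δ))
      (hμs := measure_ne_top μ _) (c := (1 : ℂ))
    filter_upwards [hg, hγc, hind, hnp.coeFn_toLp,
      Lp.coeFn_add (((|r| * (‖p‖ * ‖γ‖) : ℝ) : ℂ) •
        indicatorVec (measurableSet_Ioc (a := c) (b := c + δ)))
        (((|r| * (√δ * ‖γ‖) : ℝ) : ℂ) • hnp.toLp),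
      Lp.coeFn_smul ((|r| * (‖p‖ * ‖γ‖) : ℝ) : ℂ)
        (indicatorVec (measurableSet_Ioc (a := c) (b := c + δ))),
      Lp.coeFn_smul ((|r| * (√δ * ‖γ‖) : ℝ) : ℂ) hnp.toLp] with x h1 h2 h3 h4 h5 h6 h7
    rw [h2, h5, Pi.add_apply, h6, h7, Pi.smul_apply, Pi.smul_apply, h4, indicatorVec, h3]
    by_cases hx : x ∈ Set.Ioc c (c + δ)
    · rw [Set.indicator_of_mem hx, Set.indicator_of_mem hx, h1, hprim x hx.2, hprimMul x hx.2,
        smul_eq_mul, smul_eq_mul, mul_one, ← Complex.ofReal_mul, ← Complex.ofReal_add, norm_mul,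
        Complex.norm_real, Complex.norm_real, Real.norm_eq_abs, Real.norm_of_nonneg (by positivity)]
      have h8 := norm_prim_sub_le γ hx.1.le
      rw [hprimc, sub_zero] at h8
      have h9 : √(x - c) ≤ √δ := Real.sqrt_le_sqrt (by linarith [hx.2])
      calc |r| * ‖primMul p γ x - p x * prim γ x‖
          ≤ |r| * (‖p‖ * ‖γ‖ + ‖p x‖ * (√δ * ‖γ‖)) := by
            gcongr
            refine (norm_sub_le _ _).trans (add_le_add (norm_primMul_le p γ x) ?_)
            rw [norm_mul]
            gcongr
            exact h8.trans (by gcongr)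
        _ = _ := by ring
    · rw [Set.indicator_of_notMem hx, norm_zero]
      exact norm_nonneg _
  have hnpn : ‖hnp.toLp‖ ≤ ‖p‖ := by
    refine Lp.norm_le_norm_of_ae_le ?_
    filter_upwards [hnp.coeFn_toLp] with x hx
    rw [hx, Complex.norm_real, norm_norm]
  have hγ0 : ‖γ‖ = 0 := by
    have h1 : ‖indicatorVec (measurableSet_Ioc (a := c) (b := c + δ))‖ ≤ √δ := by
      have := norm_indicatorVec_Ioc_le (s := c) (t := c + δ) (by linarith)
      rwa [add_sub_cancel_left] at this
    have h2 : ‖γ‖ ≤ |r| * (‖p‖ * ‖γ‖) * √δ + |r| * (√δ * ‖γ‖) * ‖p‖ := by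
      refine hγle.trans ((norm_add_le _ _).trans ?_)
      rw [norm_smul, norm_smul, Complex.norm_real, Complex.norm_real,
        Real.norm_of_nonneg (by positivity), Real.norm_of_nonneg (by positivity)]
      gcongr
    have h3 : ‖γ‖ * (1 - 2 * |r| * √δ * ‖p‖) ≤ 0 := by nlinarith
    have h4 : ‖γ‖ ≤ 0 := by
      by_contra! h
      have := mul_pos h (sub_pos.2 hsmall)
      linarith
    exact le_antisymm h4 (norm_nonneg _)
  have hγz : γ = 0 := norm_eq_zero.1 hγ0
  filter_upwards [hgγ, Lp.coeFn_zero ℂ 2 μ] with x h1 h2 hx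
  rw [h1 hx, hγz, h2, Pi.zero_apply]

theorem eq_zero_of_quasiderivative_eq_zero (p : UnitL2) (g : UnitL2) {r : ℝ}
    (hg : ∀ᵐ x ∂(volume.restrict (Set.Icc (0 : ℝ) 1)),
      g x = r * (primMul p g x - p x * prim g x)) : g = 0 := by
  obtain ⟨δ, hδ, hsmall⟩ : ∃ δ > 0, 2 * |r| * √δ * ‖p‖ < 1 := by
    have h : Tendsto (fun δ => 2 * |r| * √δ * ‖p‖) (𝓝[>] 0) (𝓝 0) := by
      have : Continuous fun δ => 2 * |r| * √δ * ‖p‖ := by fun_prop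
      have h1 := this.tendsto 0
      simp only [Real.sqrt_zero, mul_zero, zero_mul] at h1
      exact h1.mono_left nhdsWithin_le_nhds
    obtain ⟨δ, h1, h2⟩ := ((h.eventually_lt_const one_pos).and self_mem_nhdsWithin).exists
    exact ⟨δ, h2, h1⟩
  have hall : ∀ k : ℕ, ∀ᵐ x ∂(volume.restrict (Set.Icc (0 : ℝ) 1)), x ≤ k * δ → g x = 0 := by
    intro k
    induction k with
    | zero =>
      have h0 : ∀ᵐ x ∂(volume.restrict (Set.Icc (0 : ℝ) 1)), x ≠ 0 :=
        ae_restrict_of_ae (compl_mem_ae_iff.2 (measure_singleton 0))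
      filter_upwards [h0, ae_restrict_mem measurableSet_Icc] with x h1 h2 hx
      simp only [Nat.cast_zero, zero_mul] at hx
      exact absurd (le_antisymm hx h2.1) h1
    | succ k ih =>
      have := ae_eq_zero_step p g hδ.le hsmall hg ih
      have h1 : ((k + 1 : ℕ) : ℝ) * δ = k * δ + δ := by push_cast; ring
      rwa [h1]
  obtain ⟨k, hk⟩ := exists_nat_gt (1 / δ)
  refine Lp.ext ?_
  filter_upwards [hall k, ae_restrict_mem measurableSet_Icc, Lp.coeFn_zero ℂ 2
    (volume.restrict (Set.Icc (0 : ℝ) 1))] with x h1 h2 h3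
  rw [h3, h1, Pi.zero_apply]
  have := (div_lt_iff₀ hδ).1 hk
  linarith [h2.2]

/-- The constant `κ` of the quasi-derivative determines the solution. -/
theorem hasSimpleCharValues_stringOperator {P : ℝ → ℝ}
    (hP : MemLp P 2 (volume.restrict (Set.Icc (0 : ℝ) 1))) :
    HasSimpleCharValues (stringOperator (toUnitL2 hP)) := by
  intro r _ g h hg0 hg hh
  obtain ⟨κ, hκ⟩ := exists_quasiderivative_eq hP hg
  obtain ⟨κ', hκ'⟩ := exists_quasiderivative_eq hP hh
  set p := toUnitL2 hP
  have hκ0 : κ ≠ 0 := by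
    rintro rfl
    refine hg0 (Subtype.ext (eq_zero_of_quasiderivative_eq_zero p g (r := r) ?_))
    filter_upwards [hκ] with x hx
    rw [hx, zero_add]
  refine ⟨κ' / κ, ?_⟩
  set c := κ' / κ
  have hc : κ' = c * κ := (div_mul_cancel₀ _ hκ0).symm
  have hsub : ((h : UnitL2) - c • (g : UnitL2)) = 0 := by
    refine eq_zero_of_quasiderivative_eq_zero p _ (r := r) ?_
    have h1 : ∀ᵐ x ∂(volume.restrict (Set.Icc (0 : ℝ) 1)),
        ((h : UnitL2) - c • (g : UnitL2) : UnitL2) x = (h : UnitL2) x - c * (g : UnitL2) x := by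
      filter_upwards [Lp.coeFn_sub (h : UnitL2) (c • (g : UnitL2)),
        Lp.coeFn_smul c (g : UnitL2)] with x h1 h2
      rw [h1, Pi.sub_apply, h2, Pi.smul_apply, smul_eq_mul]
    have h2 : ∀ x, primMul p ((h : UnitL2) - c • (g : UnitL2)) x =
        primMul p h x - c * primMul p g x := by
      intro x
      rw [primMul, primMul, primMul, ← integral_const_mul, ← integral_sub
        (integrable_mul_unitL2 p h).integrableOn
        ((integrable_mul_unitL2 p g).integrableOn.const_mul c)]
      refine integral_congr_ae (ae_restrict_of_ae ?_)
      filter_upwards [h1] with t ht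
      rw [ht]; ring
    have h3 : ∀ x, prim ((h : UnitL2) - c • (g : UnitL2)) x =
        prim (h : UnitL2) x - c * prim (g : UnitL2) x := fun x => by
      rw [prim_eq_inner, prim_eq_inner, prim_eq_inner, inner_sub_right, inner_smul_right]
    filter_upwards [hκ, hκ', h1] with x hx hx' h1x
    rw [h1x, h2, h3, hx, hx', hc]
    ring
  refine Subtype.ext ?_
  rw [sub_eq_zero] at hsub
  exact hsub

theorem pencilForm_prim {P : ℝ → ℝ} (hP : MemLp P 2 (volume.restrict (Set.Icc (0 : ℝ) 1)))
    (r : ℝ) (g h : energySpace) :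
    pencilForm P r (prim (g : UnitL2)) (prim (h : UnitL2)) =
      inner ℂ h (g - (r : ℂ) • stringOperator (toUnitL2 hP) g) := by
  have hg := memH_prim g.2
  have hh := memH_prim h.2
  have h0 : inner ℂ h ((r : ℂ) • stringOperator (toUnitL2 hP) g) =
      r * inner ℂ h (stringOperator (toUnitL2 hP) g) :=
    inner_smul_right (𝕜 := ℂ) (E := energySpace) _ _ _
  rw [inner_sub_right, h0, inner_stringOperator_eq_pairing, pairing]
  have h1 : inner ℂ h g = inner ℂ (h : UnitL2) (g : UnitL2) := rfl
  rw [h1, inner_energySpace, pencilForm]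
  have hi1 : IntervalIntegrable (fun x => conj (deriv (prim (h : UnitL2)) x) *
      deriv (prim (g : UnitL2)) x) volume 0 1 := by
    rw [intervalIntegrable_iff_integrableOn_Icc_of_le zero_le_one]
    exact MemLp.integrable_mul (p := 2) (q := 2) hh.deriv_memLp.star hg.deriv_memLp
  have hi2 : IntervalIntegrable (fun x => (P x : ℂ) *
      deriv (fun t => prim (g : UnitL2) t * conj (prim (h : UnitL2) t)) x) volume 0 1 := by
    rw [intervalIntegrable_iff_integrableOn_Icc_of_le zero_le_one]
    exact MemLp.integrable_mul (p := 2) (q := 2) (hP.ofReal (K := ℂ)) (hg.mul_conj hh).deriv_memLp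
  rw [mul_neg, sub_neg_eq_add, ← intervalIntegral.integral_const_mul,
    ← intervalIntegral.integral_add hi1 (hi2.const_mul _)]
  refine intervalIntegral.integral_congr fun x _ => ?_
  simp only [mul_comm (deriv _ x) (conj _), mul_assoc]

theorem isSolution_prim_iff {P : ℝ → ℝ} (hP : MemLp P 2 (volume.restrict (Set.Icc (0 : ℝ) 1)))
    (r : ℝ) (g : energySpace) :
    IsSolution P r (prim (g : UnitL2)) ↔ g = (r : ℂ) • stringOperator (toUnitL2 hP) g := by
  rw [← sub_eq_zero]
  constructor
  · intro h
    refine ext_inner_left ℂ fun v => ?_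
    rw [inner_zero_right]
    exact (pencilForm_prim hP r g v).symm.trans (h.2 _ (memH_prim v.2))
  · intro h
    refine ⟨memH_prim g.2, fun z hz => ?_⟩
    rw [← prim_ofMemH hz, pencilForm_prim hP, h, inner_zero_right]

theorem prim_zero : prim 0 = 0 := by
  funext x
  rw [prim_eq_inner, inner_zero_right]; rfl

/-- The positive eigenvalues of the boundary problem are the characteristic values of the operator
of the string. -/
theorem setOf_isEigenvalue_eq {P : ℝ → ℝ} (hP : MemLp P 2 (volume.restrict (Set.Icc (0 : ℝ) 1))) :
    {x : ℝ | 0 < x ∧ IsEigenvalue P x} = charValues (stringOperator (toUnitL2 hP)) := by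
  ext r
  refine and_congr_right fun _ => ⟨?_, ?_⟩
  · rintro ⟨y, hy, hy0⟩
    refine ⟨ofMemH hy.1, fun h => hy0 ?_, (isSolution_prim_iff hP r _).1 ?_⟩
    · rw [← prim_ofMemH hy.1, h]
      exact prim_zero
    · rwa [prim_ofMemH hy.1]
  · rintro ⟨g, hg0, hg⟩
    refine ⟨prim (g : UnitL2), (isSolution_prim_iff hP r g).2 hg, fun h => hg0 ?_⟩
    exact Subtype.ext (prim_injective (h.trans prim_zero.symm))

theorem isSimpleEigenvalue_of_mem_charValues {P : ℝ → ℝ}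
    (hP : MemLp P 2 (volume.restrict (Set.Icc (0 : ℝ) 1))) {r : ℝ}
    (hr : r ∈ charValues (stringOperator (toUnitL2 hP))) : IsSimpleEigenvalue P r := by
  obtain ⟨hr0, g, hg0, hg⟩ := hr
  refine ⟨prim (g : UnitL2), ⟨(isSolution_prim_iff hP r g).2 hg, fun h => hg0 ?_⟩, fun z hz => ?_⟩
  · exact Subtype.ext (prim_injective (h.trans prim_zero.symm))
  · obtain ⟨c, hc⟩ := hasSimpleCharValues_stringOperator hP r hr0 g (ofMemH hz.1) hg0 hg
      ((isSolution_prim_iff hP r _).1 (by rwa [prim_ofMemH hz.1]))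
    refine ⟨c, ?_⟩
    rw [← prim_ofMemH hz.1, hc, ← prim_smul]
    rfl

/-! ### The cut points and the values of a self-similar function -/

section Geometry

variable {n m : ℕ} {a d β : ℕ → ℝ} {P : ℝ → ℝ}

theorem cutPoint_zero (a : ℕ → ℝ) : cutPoint a 0 = 0 := by simp [cutPoint]

theorem cutPoint_succ (a : ℕ → ℝ) (k : ℕ) : cutPoint a (k + 1) = cutPoint a k + a (k + 1) := by
  rw [cutPoint, cutPoint, Finset.sum_Icc_succ_top (by omega)]

theorem cutPoint_eq_add {k : ℕ} (hk : 1 ≤ k) : cutPoint a k = cutPoint a (k - 1) + a k := by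
  obtain ⟨j, rfl⟩ := Nat.exists_eq_add_of_le' hk
  rw [Nat.add_sub_cancel, cutPoint_succ]

theorem AdmissibleParams.cutPoint_last (h : AdmissibleParams n a d) : cutPoint a n = 1 :=
  h.sum_eq_one

theorem AdmissibleParams.cutPoint_mono (h : AdmissibleParams n a d) {j k : ℕ} (hjk : j ≤ k)
    (hk : k ≤ n) : cutPoint a j ≤ cutPoint a k :=
  Finset.sum_le_sum_of_subset_of_nonneg (Finset.Icc_subset_Icc_right hjk) fun i hi _ =>
    (h.pos i (Finset.Icc_subset_Icc_right hk hi)).le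

theorem AdmissibleParams.cutPoint_add_le (h : AdmissibleParams n a d) {j k : ℕ} (hjk : j < k)
    (hk : k ≤ n) : cutPoint a j + a (j + 1) ≤ cutPoint a k := by
  rw [← cutPoint_succ]
  exact h.cutPoint_mono hjk hk

theorem AdmissibleParams.cutPoint_nonneg (h : AdmissibleParams n a d) {k : ℕ} (hk : k ≤ n) :
    0 ≤ cutPoint a k := by
  rw [← cutPoint_zero a]
  exact h.cutPoint_mono (Nat.zero_le k) hk

theorem AdmissibleParams.cutPoint_le_one (h : AdmissibleParams n a d) {k : ℕ} (hk : k ≤ n) :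
    cutPoint a k ≤ 1 := by
  rw [← h.cutPoint_last]
  exact h.cutPoint_mono hk le_rfl

theorem AdmissibleParams.mul_lt_one (h : AdmissibleParams n a d) (hm : m ∈ Finset.Icc 1 n)
    (hdm : 0 < d m) : a m * d m < 1 := by
  have ha := h.pos m hm
  have h1 : a m ≤ 1 := by
    rw [← h.sum_eq_one]
    exact Finset.single_le_sum (f := a) (fun i hi => (h.pos i hi).le) hm
  have h2 : a m * d m ^ 2 < 1 := by
    refine lt_of_le_of_lt ?_ h.sum_lt_one
    have := Finset.single_le_sum (f := fun k => a k * |d k| ^ 2)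
      (fun i hi => mul_nonneg (h.pos i hi).le (by positivity)) hm
    simpa using this
  have h3 : (a m * d m) ^ 2 < 1 := by
    calc (a m * d m) ^ 2 = a m * (a m * d m ^ 2) := by ring
      _ ≤ 1 * (a m * d m ^ 2) := by gcongr
      _ < 1 := by linarith
  exact (sq_lt_one_iff₀ (by positivity)).1 h3

/-- A length that is smaller than all the pieces of `[0,1]` and all their copies in the `m`-th
piece. -/
theorem AdmissibleParams.exists_small (h : AdmissibleParams n a d) (hm : m ∈ Finset.Icc 1 n) :
    ∃ ε, 0 < ε ∧ ∀ k ∈ Finset.Icc 1 n, ε ≤ a k ∧ ε ≤ a m * a k := by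
  obtain ⟨i, hi, hmin⟩ := Finset.exists_min_image (Finset.Icc 1 n) a ⟨m, hm⟩
  have hpos := h.pos i hi
  have h1 : a i ≤ 1 := by
    rw [← h.sum_eq_one]
    exact Finset.single_le_sum (f := a) (fun i hi => (h.pos i hi).le) hi
  refine ⟨a i * a i, by positivity, fun k hk => ⟨?_, ?_⟩⟩
  · exact (mul_le_of_le_one_left hpos.le h1).trans (hmin k hk)
  · exact mul_le_mul (hmin m hm) (hmin k hk) hpos.le (h.pos m hm).le

theorem IsSelfSimilar.ae_eq_of_mem_piece (hP : IsSelfSimilar n a d β P)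
    (h : AdmissibleParams n a d) {k : ℕ} (hk : k ∈ Finset.Icc 1 n) :
    ∀ᵐ x, x ∈ Set.Ioo (cutPoint a (k - 1)) (cutPoint a k) →
      P x = β k + d k * P ((x - cutPoint a (k - 1)) / a k) := by
  have hkn := (Finset.mem_Icc.1 hk)
  filter_upwards [(ae_restrict_iff' measurableSet_Icc).1 hP.fixed] with x hx hxk
  have hx01 : x ∈ Set.Icc (0 : ℝ) 1 :=
    ⟨(h.cutPoint_nonneg (by omega)).trans hxk.1.le, hxk.2.le.trans (h.cutPoint_le_one hkn.2)⟩
  rw [← hx hx01, similarityOp, Finset.sum_eq_single k, Set.indicator_of_mem hxk]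
  · intro j hj hjk
    refine Set.indicator_of_notMem (fun hxj => ?_) _
    rcases lt_or_gt_of_ne hjk with h1 | h1
    · have := h.cutPoint_mono (j := j) (k := k - 1) (by omega) (by omega)
      linarith [hxj.2, hxk.1]
    · have := h.cutPoint_mono (j := k) (k := j - 1) (by omega)
        (by have := (Finset.mem_Icc.1 hj).2; omega)
      linarith [hxj.1, hxk.2]
  · exact fun h => absurd hk h

variable (n m d β) in
/-- The value of `P` immediately to the left of the `k`-th cut point. -/
noncomputable def leftValue (k : ℕ) : ℝ := if k = m then β m + d m * β n else β k

variable (m d β) in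
/-- The value of `P` immediately to the right of the `k`-th cut point. -/
noncomputable def rightValue (k : ℕ) : ℝ := if k + 1 = m then β m + d m * β 1 else β (k + 1)

theorem rightValue_sub_leftValue (k : ℕ) :
    rightValue m d β k - leftValue n m d β k = zeta n m d β k := by
  rw [rightValue, leftValue, zeta]
  by_cases h1 : k + 1 = m
  · rw [if_pos h1, if_pos h1, if_neg (by omega)]; ring
  · by_cases h2 : k = m
    · rw [if_neg h1, if_pos h2, if_neg h1, if_pos h2, h2]; ring
    · rw [if_neg h1, if_neg h2, if_neg h1, if_neg h2]

theorem IsSelfSimilar.ae_eq_leftValue (hP : IsSelfSimilar n a d β P)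
    (h : AdmissibleParams n a d) (hm : m ∈ Finset.Icc 1 n)
    (hd : ∀ k ∈ Finset.Icc 1 n, k ≠ m → d k = 0) {ε : ℝ}
    (hε : ∀ k ∈ Finset.Icc 1 n, ε ≤ a k ∧ ε ≤ a m * a k) {k : ℕ}
    (hk : k ∈ Finset.Icc 1 (n - 1)) :
    ∀ᵐ x, x ∈ Set.Ioo (cutPoint a k - ε) (cutPoint a k) → P x = leftValue n m d β k := by
  obtain ⟨hk1, hk2⟩ := Finset.mem_Icc.1 hk
  have hkn : k ∈ Finset.Icc 1 n := Finset.mem_Icc.2 ⟨hk1, by omega⟩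
  have hcut := cutPoint_eq_add (a := a) hk1
  have hmem : ∀ x, x ∈ Set.Ioo (cutPoint a k - ε) (cutPoint a k) →
      x ∈ Set.Ioo (cutPoint a (k - 1)) (cutPoint a k) := fun x hx =>
    ⟨by linarith [hx.1, (hε k hkn).1], hx.2⟩
  by_cases hkm : k = m
  · -- the last piece lies in the `m`-th piece as its copy
    subst hkm
    have hak := h.pos k hm
    have hnn : n ∈ Finset.Icc 1 n := Finset.mem_Icc.2 ⟨by omega, le_rfl⟩
    have hcutn := cutPoint_eq_add (a := a) (k := n) (by omega)
    rw [h.cutPoint_last] at hcutn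
    filter_upwards [hP.ae_eq_of_mem_piece h hm, ae_comp_mul_add (inv_pos.2 hak).ne'
      (-((a k)⁻¹ * cutPoint a (k - 1))) (hP.ae_eq_of_mem_piece h hnn)] with x h1 h2 hx
    have hS : (a k)⁻¹ * x + -((a k)⁻¹ * cutPoint a (k - 1)) = (x - cutPoint a (k - 1)) / a k := by
      field_simp; ring
    rw [hS, hd n hnn (by omega), zero_mul, add_zero, h.cutPoint_last] at h2
    rw [h1 (hmem x hx), h2, leftValue, if_pos rfl]
    constructor
    · rw [lt_div_iff₀ hak]
      have := (hε n hnn).2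
      nlinarith [hx.1]
    · rw [div_lt_one hak]
      linarith [hx.2]
  · filter_upwards [hP.ae_eq_of_mem_piece h hkn] with x h1 hx
    rw [h1 (hmem x hx), hd k hkn hkm, leftValue, if_neg hkm]
    ring

theorem IsSelfSimilar.ae_eq_rightValue (hP : IsSelfSimilar n a d β P)
    (h : AdmissibleParams n a d) (hm : m ∈ Finset.Icc 1 n)
    (hd : ∀ k ∈ Finset.Icc 1 n, k ≠ m → d k = 0) {ε : ℝ}
    (hε : ∀ k ∈ Finset.Icc 1 n, ε ≤ a k ∧ ε ≤ a m * a k) {k : ℕ}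
    (hk : k ∈ Finset.Icc 1 (n - 1)) :
    ∀ᵐ x, x ∈ Set.Ioo (cutPoint a k) (cutPoint a k + ε) → P x = rightValue m d β k := by
  obtain ⟨hk1, hk2⟩ := Finset.mem_Icc.1 hk
  have hkn : k + 1 ∈ Finset.Icc 1 n := Finset.mem_Icc.2 ⟨by omega, by omega⟩
  have hcut := cutPoint_succ a k
  have hmem : ∀ x, x ∈ Set.Ioo (cutPoint a k) (cutPoint a k + ε) →
      x ∈ Set.Ioo (cutPoint a k) (cutPoint a (k + 1)) := fun x hx =>
    ⟨hx.1, by linarith [hx.2, (hε (k + 1) hkn).1]⟩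
  have hpiece := hP.ae_eq_of_mem_piece h hkn
  rw [Nat.add_sub_cancel] at hpiece
  by_cases hkm : k + 1 = m
  · -- the first piece lies in the `m`-th piece as its copy
    subst hkm
    have hak := h.pos (k + 1) hm
    have h11 : 1 ∈ Finset.Icc 1 n := Finset.mem_Icc.2 ⟨le_rfl, by omega⟩
    have hcut1 : cutPoint a 1 = a 1 := by
      rw [cutPoint_eq_add le_rfl, Nat.sub_self, cutPoint_zero, zero_add]
    filter_upwards [hpiece, ae_comp_mul_add (inv_pos.2 hak).ne'
      (-((a (k + 1))⁻¹ * cutPoint a k)) (hP.ae_eq_of_mem_piece h h11)] with x h1 h2 hx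
    have hS : (a (k + 1))⁻¹ * x + -((a (k + 1))⁻¹ * cutPoint a k) =
        (x - cutPoint a k) / a (k + 1) := by
      field_simp; ring
    rw [hS, hd 1 h11 (by omega), zero_mul, add_zero, Nat.sub_self, cutPoint_zero, hcut1] at h2
    rw [h1 (hmem x hx), h2, rightValue, if_pos rfl]
    constructor
    · exact div_pos (by linarith [hx.1]) hak
    · rw [div_lt_iff₀ hak]
      have := (hε 1 h11).2
      nlinarith [hx.2]
  · filter_upwards [hpiece] with x h1 hx
    rw [h1 (hmem x hx), hd (k + 1) hkn hkm, rightValue, if_neg hkm]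
    ring

/-! ### The pairing with `P'` -/

theorem intervalIntegrable_mul_deriv (hP : MemLp P 2 (volume.restrict (Set.Icc (0 : ℝ) 1)))
    {p : ℝ → ℂ} (hp : MemH p) {s t : ℝ} (hs : s ∈ Set.Icc (0 : ℝ) 1) (ht : t ∈ Set.Icc (0 : ℝ) 1) :
    IntervalIntegrable (fun x => (P x : ℂ) * deriv p x) volume s t := by
  have h : IntervalIntegrable (fun x => (P x : ℂ) * deriv p x) volume 0 1 := by
    rw [intervalIntegrable_iff_integrableOn_Icc_of_le zero_le_one]
    exact MemLp.integrable_mul (p := 2) (q := 2) (hP.ofReal (K := ℂ)) hp.deriv_memLp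
  refine h.mono_set ?_
  rw [Set.uIcc_of_le zero_le_one]
  exact Set.uIcc_subset_Icc hs ht

/-- If `P` is constant on both sides of `c` in the support of `p`, then the pairing of `P'` with
`p` is the jump of `P` times `p c`. -/
theorem pairing_eq_jump (hP : MemLp P 2 (volume.restrict (Set.Icc (0 : ℝ) 1)))
    {p : ℝ → ℂ} (hp : MemH p) {c ε L R : ℝ} (hc : c ∈ Set.Icc (0 : ℝ) 1)
    (hp0 : ∀ x, x ∉ Set.Ioo (c - ε) (c + ε) → p x = 0)
    (hL : ∀ᵐ x, x ∈ Set.Ioo (c - ε) c → P x = L) (hR : ∀ᵐ x, x ∈ Set.Ioo c (c + ε) → P x = R) :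
    pairing P p = ((R - L : ℝ) : ℂ) * p c := by
  have hderiv : ∀ x, x ∉ Set.Icc (c - ε) (c + ε) → deriv p x = 0 := fun x hx => by
    have h : p =ᶠ[𝓝 x] fun _ => 0 := by
      filter_upwards [isClosed_Icc.isOpen_compl.mem_nhds hx] with t ht
      exact hp0 t fun h => ht (Set.Ioo_subset_Icc_self h)
    rw [h.deriv_eq, deriv_const]
  have h01 : (0 : ℝ) ∈ Set.Icc (0 : ℝ) 1 := by simp
  have h11 : (1 : ℝ) ∈ Set.Icc (0 : ℝ) 1 := by simp
  have hne : ∀ t : ℝ, ∀ᵐ x, x ≠ t := fun t => compl_mem_ae_iff.2 (measure_singleton t)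
  have h1 : ∫ x in (0 : ℝ)..c, (P x : ℂ) * deriv p x = ∫ x in (0 : ℝ)..c, (L : ℂ) * deriv p x := by
    refine intervalIntegral.integral_congr_ae ?_
    filter_upwards [hL, hne (c - ε), hne c] with x hx hx1 hx2 hx0
    rw [Set.uIoc_of_le hc.1] at hx0
    by_cases h : c - ε ≤ x
    · rw [hx ⟨lt_of_le_of_ne h (Ne.symm hx1), lt_of_le_of_ne hx0.2 hx2⟩]
    · rw [hderiv x fun h' => h h'.1, mul_zero, mul_zero]
  have h2 : ∫ x in c..(1 : ℝ), (P x : ℂ) * deriv p x = ∫ x in c..(1 : ℝ), (R : ℂ) * deriv p x := by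
    refine intervalIntegral.integral_congr_ae ?_
    filter_upwards [hR, hne (c + ε)] with x hx hx1 hx0
    rw [Set.uIoc_of_le hc.2] at hx0
    by_cases h : x ≤ c + ε
    · rw [hx ⟨hx0.1, lt_of_le_of_ne h hx1⟩]
    · rw [hderiv x fun h' => h h'.2, mul_zero, mul_zero]
  rw [pairing, ← intervalIntegral.integral_add_adjacent_intervals
    (intervalIntegrable_mul_deriv hP hp h01 hc) (intervalIntegrable_mul_deriv hP hp hc h11), h1, h2,
    intervalIntegral.integral_const_mul, intervalIntegral.integral_const_mul, hp.integral_deriv,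
    hp.integral_deriv, hp.zero_off 0 (by simp), hp.zero_off 1 (by simp)]
  push_cast
  ring

/-- On functions that vanish at all the cut points the pairing with `P'` is self-similar: only the
`m`-th piece contributes to it. -/
theorem pairing_eq_mul_pairing_rescale (hP : IsSelfSimilar n a d β P)
    (h : AdmissibleParams n a d) (hm : m ∈ Finset.Icc 1 n)
    (hd : ∀ k ∈ Finset.Icc 1 n, k ≠ m → d k = 0) {p : ℝ → ℂ} (hp : MemH p)
    (hp0 : ∀ k ≤ n, p (cutPoint a k) = 0) :
    pairing P p = d m * pairing P
      ((Set.Ioo (0 : ℝ) 1).indicator fun x => p (a m * x + cutPoint a (m - 1))) := by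
  obtain ⟨hm1, hmn⟩ := Finset.mem_Icc.1 hm
  have ham := h.pos m hm
  have hmem : ∀ k ≤ n, cutPoint a k ∈ Set.Icc (0 : ℝ) 1 := fun k hk =>
    ⟨h.cutPoint_nonneg hk, h.cutPoint_le_one hk⟩
  have hsum := intervalIntegral.sum_integral_adjacent_intervals (μ := volume)
    (f := fun x => (P x : ℂ) * deriv p x) (a := cutPoint a) (n := n) fun k hk =>
    intervalIntegrable_mul_deriv hP.memLp hp (hmem k hk.le) (hmem (k + 1) hk)
  rw [cutPoint_zero, h.cutPoint_last] at hsum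
  have hne : ∀ t : ℝ, ∀ᵐ x, x ≠ t := fun t => compl_mem_ae_iff.2 (measure_singleton t)
  have hpiece : ∀ k ∈ Finset.Icc 1 n, ∫ x in cutPoint a (k - 1)..cutPoint a k,
      (P x : ℂ) * deriv p x = ∫ x in cutPoint a (k - 1)..cutPoint a k,
        (d k : ℂ) * ((P ((x - cutPoint a (k - 1)) / a k) : ℂ) * deriv p x) := by
    intro k hk
    obtain ⟨hk1, hkn⟩ := Finset.mem_Icc.1 hk
    have hle := h.cutPoint_mono (j := k - 1) (k := k) (by omega) hkn
    have hi := intervalIntegrable_mul_deriv hP.memLp hp (hmem (k - 1) (by omega)) (hmem k hkn)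
    have hβ : ∫ x in cutPoint a (k - 1)..cutPoint a k, (β k : ℂ) * deriv p x = 0 := by
      rw [intervalIntegral.integral_const_mul, hp.integral_deriv, hp0 k hkn,
        hp0 (k - 1) (by omega), sub_zero, mul_zero]
    rw [← sub_zero (∫ x in cutPoint a (k - 1)..cutPoint a k, (P x : ℂ) * deriv p x), ← hβ,
      ← intervalIntegral.integral_sub hi
        (hp.isPrimitive.integrable.intervalIntegrable.const_mul _)]
    refine intervalIntegral.integral_congr_ae ?_
    filter_upwards [hP.ae_eq_of_mem_piece h hk, hne (cutPoint a k)] with x hx hxk hx'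
    rw [Set.uIoc_of_le hle] at hx'
    rw [hx ⟨hx'.1, lt_of_le_of_ne hx'.2 hxk⟩]
    push_cast
    ring
  have hsingle : ∑ k ∈ Finset.range n, ∫ x in cutPoint a k..cutPoint a (k + 1),
      (P x : ℂ) * deriv p x = ∫ x in cutPoint a (m - 1)..cutPoint a m, (P x : ℂ) * deriv p x := by
    rw [Finset.sum_eq_single (m - 1)]
    · rw [Nat.sub_add_cancel hm1]
    · intro k hk hkm
      have hk' : k + 1 ∈ Finset.Icc 1 n :=
        Finset.mem_Icc.2 ⟨by omega, by have := Finset.mem_range.1 hk; omega⟩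
      have := hpiece (k + 1) hk'
      rw [Nat.add_sub_cancel] at this
      rw [this, hd (k + 1) hk' (by omega)]
      simp
    · exact fun h' => absurd (Finset.mem_range.2 (by omega)) h'
  rw [hsingle, hpiece m hm, intervalIntegral.integral_const_mul] at hsum
  have hscale := intervalIntegral.integral_comp_mul_add (a := (0 : ℝ)) (b := 1)
    (fun x => (P ((x - cutPoint a (m - 1)) / a m) : ℂ) * deriv p x) ham.ne' (cutPoint a (m - 1))
  have hcut := cutPoint_eq_add (a := a) hm1
  have hend : a m * 1 + cutPoint a (m - 1) = cutPoint a m := by rw [hcut]; ring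
  rw [mul_zero, zero_add, hend] at hscale
  have hprim := (hp.isPrimitive.comp_mul_add ham.ne' (cutPoint a (m - 1))).indicator zero_le_one
    (by rw [mul_zero, zero_add]; exact hp0 _ (by omega)) (by rw [hend]; exact hp0 _ hmn)
  have hderiv : ∫ x in (0 : ℝ)..1, (P x : ℂ) * deriv ((Set.Ioo (0 : ℝ) 1).indicator fun x =>
      p (a m * x + cutPoint a (m - 1))) x = a m * ∫ x in (0 : ℝ)..1,
        (P ((a m * x + cutPoint a (m - 1) - cutPoint a (m - 1)) / a m) : ℂ) *
          deriv p (a m * x + cutPoint a (m - 1)) := by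
    rw [← intervalIntegral.integral_const_mul]
    refine intervalIntegral.integral_congr_ae ?_
    filter_upwards [hprim.ae_deriv_eq, hne 1] with x hx hx1 hx'
    rw [Set.uIoc_of_le zero_le_one] at hx'
    rw [hx, Set.indicator_of_mem (Set.mem_Ioo.2 ⟨hx'.1, lt_of_le_of_ne hx'.2 hx1⟩),
      add_sub_cancel_right, mul_div_cancel_left₀ _ ham.ne', smul_eq_mul]
    ring
  rw [pairing, pairing, ← hsum, hderiv, hscale, Complex.real_smul]
  have hamC : (a m : ℂ) ≠ 0 := by exact_mod_cast ham.ne'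
  push_cast
  field_simp

/-- The tent function of height `1` and half-width `ε` centred at `c`. -/
noncomputable def tent (c ε x : ℝ) : ℂ := ((max 0 (1 - |x - c| / ε) : ℝ) : ℂ)

theorem tent_self (c ε : ℝ) : tent c ε c = 1 := by simp [tent]

theorem tent_eq_zero {c ε x : ℝ} (hε : 0 < ε) (hx : ε ≤ |x - c|) : tent c ε x = 0 := by
  have : 1 - |x - c| / ε ≤ 0 := by
    rw [sub_nonpos, one_le_div hε]; exact hx
  rw [tent, max_eq_left this, Complex.ofReal_zero]

theorem lipschitzWith_tent {c ε : ℝ} (hε : 0 < ε) :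
    LipschitzWith (Real.toNNReal ε⁻¹) (tent c ε) := by
  refine LipschitzWith.of_dist_le_mul fun x y => ?_
  rw [tent, tent, Complex.isometry_ofReal.dist_eq, Real.coe_toNNReal _ (inv_pos.2 hε).le,
    Real.dist_eq, Real.dist_eq, max_comm 0, max_comm 0]
  refine (abs_max_sub_max_le_abs _ _ _).trans ?_
  have h1 : 1 - |x - c| / ε - (1 - |y - c| / ε) = ε⁻¹ * (|y - c| - |x - c|) := by
    field_simp; ring
  have h2 : x - y = -((y - c) - (x - c)) := by ring
  rw [h1, abs_mul, abs_of_pos (inv_pos.2 hε), h2, abs_neg]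
  exact mul_le_mul_of_nonneg_left (abs_abs_sub_abs_le_abs_sub _ _) (inv_pos.2 hε).le

theorem memH_tent {c ε : ℝ} (hε : 0 < ε) (h0 : ε ≤ c) (h1 : c + ε ≤ 1) : MemH (tent c ε) where
  ac := (lipschitzWith_tent hε).lipschitzOnWith.absolutelyContinuousOnInterval
  deriv_memLp := MemLp.of_bound (measurable_deriv _).aestronglyMeasurable _
    (Eventually.of_forall fun _ => norm_deriv_le_of_lipschitz (lipschitzWith_tent hε))
  zero_off x hx := by
    refine tent_eq_zero hε ?_
    rw [Set.mem_Ioo, not_and_or, not_lt, not_lt] at hx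
    rcases hx with hx | hx
    · rw [abs_sub_comm]; exact (by linarith : ε ≤ c - x).trans (le_abs_self _)
    · exact (by linarith : ε ≤ x - c).trans (le_abs_self _)

end Geometry

/-! ### The energy space under rescaling -/

theorem norm_sq_energySpace (g : energySpace) :
    ‖g‖ ^ 2 = ∫ x : ℝ, ‖deriv (prim (g : UnitL2)) x‖ ^ 2 := by
  have h1 : ((‖(g : UnitL2)‖ ^ 2 : ℝ) : ℂ) =
      ((∫ x in (0 : ℝ)..1, ‖deriv (prim (g : UnitL2)) x‖ ^ 2 : ℝ) : ℂ) := by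
    have h2 : inner ℂ (g : UnitL2) (g : UnitL2) = (‖(g : UnitL2)‖ : ℂ) ^ 2 :=
      inner_self_eq_norm_sq_to_K _
    rw [Complex.ofReal_pow, ← h2, inner_energySpace, ← intervalIntegral.integral_ofReal]
    refine intervalIntegral.integral_congr fun x _ => ?_
    simp only [Complex.conj_mul', Complex.ofReal_pow]
  have h3 := Complex.ofReal_injective h1
  rw [Submodule.coe_norm, h3, intervalIntegral.integral_of_le zero_le_one,
    ← integral_Icc_eq_integral_Ioc]
  refine setIntegral_eq_integral_of_forall_compl_eq_zero fun x hx => ?_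
  rw [(memH_prim g.2).deriv_eq_zero hx, norm_zero, zero_pow two_ne_zero]

theorem inner_eq_zero_of_ae_deriv {g h : energySpace}
    (hgh : ∀ᵐ x, deriv (prim (g : UnitL2)) x = 0 ∨ deriv (prim (h : UnitL2)) x = 0) :
    inner ℂ g h = 0 := by
  have h1 : inner ℂ g h = inner ℂ (g : UnitL2) (h : UnitL2) := rfl
  rw [h1, inner_energySpace, intervalIntegral.integral_of_le zero_le_one]
  refine integral_eq_zero_of_ae (ae_restrict_of_ae ?_)
  filter_upwards [hgh] with x hx
  rcases hx with hx | hx <;> simp [hx]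

theorem energySpace_ext {g h : energySpace}
    (hgh : ∀ x, prim (g : UnitL2) x = prim (h : UnitL2) x) : g = h :=
  Subtype.ext (prim_injective (funext hgh))

/-- The evaluation at a point. -/
noncomputable def evalAt (x : ℝ) : energySpace →ₗ[ℂ] ℂ where
  toFun g := prim (g : UnitL2) x
  map_add' g h := by rw [Submodule.coe_add, prim_add, Pi.add_apply]
  map_smul' c g := by rw [Submodule.coe_smul, prim_smul]; rfl

theorem evalAt_apply (x : ℝ) (g : energySpace) : evalAt x g = prim (g : UnitL2) x := rfl

/-- The copy of a function on `(0, 1)` carried to the interval `(t, s + t) ⊆ (0, 1)`. -/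
noncomputable def copyIn {s t : ℝ} (hs : 0 < s) (ht : 0 ≤ t) (hst : s + t ≤ 1) :
    energySpace →ₗ[ℂ] energySpace where
  toFun g := ofMemH ((memH_prim g.2).insert hs ht hst)
  map_add' g h := energySpace_ext fun x => by
    simp only [Submodule.coe_add, prim_add, Pi.add_apply, prim_ofMemH]
  map_smul' c g := energySpace_ext fun x => by
    simp only [Submodule.coe_smul, prim_smul, Pi.smul_apply, prim_ofMemH, RingHom.id_apply]

/-- The restriction of `Q g` to `(t, s + t)`, carried to `(0, 1)`; the operator `Q` produces
functions that vanish at the ends of the interval. -/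
noncomputable def copyOut {s t : ℝ} (hs : 0 < s) (Q : energySpace →ₗ[ℂ] energySpace)
    (h0 : ∀ g, evalAt t (Q g) = 0) (h1 : ∀ g, evalAt (s + t) (Q g) = 0) :
    energySpace →ₗ[ℂ] energySpace where
  toFun g := ofMemH ((memH_prim (Q g).2).rescale hs (h0 g) (h1 g))
  map_add' g h := energySpace_ext fun x => by
    simp only [map_add, Submodule.coe_add, prim_add, Pi.add_apply, prim_ofMemH, Set.indicator_apply]
    split_ifs <;> simp
  map_smul' c g := energySpace_ext fun x => by
    simp only [map_smul, Submodule.coe_smul, prim_smul, Pi.smul_apply, prim_ofMemH,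
      RingHom.id_apply, Set.indicator_apply]
    split_ifs <;> simp

section Copies

variable {s t : ℝ} (hs : 0 < s) (ht : 0 ≤ t) (hst : s + t ≤ 1)

theorem prim_copyIn (g : energySpace) :
    prim (copyIn hs ht hst g : UnitL2) = fun x => prim (g : UnitL2) (s⁻¹ * x + -(s⁻¹ * t)) :=
  prim_ofMemH ((memH_prim g.2).insert hs ht hst)

theorem prim_copyIn_mul_add (g : energySpace) (x : ℝ) :
    prim (copyIn hs ht hst g : UnitL2) (s * x + t) = prim (g : UnitL2) x := by
  have h : s⁻¹ * (s * x + t) + -(s⁻¹ * t) = x := by field_simp; ring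
  rw [prim_copyIn]
  exact congrArg _ h

theorem prim_copyIn_eq_zero (g : energySpace) {x : ℝ} (hx : x ∉ Set.Ioo t (s + t)) :
    prim (copyIn hs ht hst g : UnitL2) x = 0 := by
  rw [prim_copyIn]
  refine (memH_prim g.2).zero_off _ fun h => hx ?_
  have h1 : s⁻¹ * x + -(s⁻¹ * t) = (x - t) / s := by field_simp; ring
  rw [h1] at h
  have h2 := (lt_div_iff₀ hs).1 h.1
  have h3 := (div_lt_one hs).1 h.2
  constructor <;> linarith

/-- Compression of a function by the factor `s` multiplies its Dirichlet integral by `1 / s`. -/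
theorem norm_sq_copyIn (g : energySpace) : ‖copyIn hs ht hst g‖ ^ 2 = s⁻¹ * ‖g‖ ^ 2 := by
  rw [norm_sq_energySpace, norm_sq_energySpace, prim_copyIn]
  have h1 := ((memH_prim g.2).isPrimitive.comp_mul_add (inv_pos.2 hs).ne' (-(s⁻¹ * t))).ae_deriv_eq
  have h2 : ∫ x : ℝ, ‖deriv (fun x => prim (g : UnitL2) (s⁻¹ * x + -(s⁻¹ * t))) x‖ ^ 2 =
      ∫ x : ℝ, (s⁻¹) ^ 2 * ‖deriv (prim (g : UnitL2)) (s⁻¹ * x + -(s⁻¹ * t))‖ ^ 2 := by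
    refine integral_congr_ae ?_
    filter_upwards [h1] with x hx
    rw [hx, norm_smul, Complex.norm_real, mul_pow, Real.norm_eq_abs, sq_abs]
  rw [h2, integral_const_mul, Measure.integral_comp_mul_left
    (fun x => ‖deriv (prim (g : UnitL2)) (x + -(s⁻¹ * t))‖ ^ 2),
    integral_add_right_eq_self (fun x => ‖deriv (prim (g : UnitL2)) x‖ ^ 2), inv_inv, abs_of_pos hs,
    smul_eq_mul]
  field_simp

variable (Q : energySpace →ₗ[ℂ] energySpace) (h0 : ∀ g, evalAt t (Q g) = 0)
  (h1 : ∀ g, evalAt (s + t) (Q g) = 0)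

theorem prim_copyOut (g : energySpace) : prim (copyOut hs Q h0 h1 g : UnitL2) =
    (Set.Ioo (0 : ℝ) 1).indicator fun x => prim (Q g : UnitL2) (s * x + t) :=
  prim_ofMemH ((memH_prim (Q g).2).rescale hs (h0 g) (h1 g))

theorem copyOut_copyIn {g : energySpace} (hg : Q (copyIn hs ht hst g) = copyIn hs ht hst g) :
    copyOut hs Q h0 h1 (copyIn hs ht hst g) = g := by
  refine energySpace_ext fun x => ?_
  rw [prim_copyOut, hg]
  by_cases hx : x ∈ Set.Ioo (0 : ℝ) 1
  · rw [Set.indicator_of_mem hx, prim_copyIn_mul_add]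
  · rw [Set.indicator_of_notMem hx, (memH_prim g.2).zero_off x hx]

theorem prim_copyIn_copyOut {g : energySpace} {x : ℝ} (hx : x ∈ Set.Ioo t (s + t)) :
    prim (copyIn hs ht hst (copyOut hs Q h0 h1 g) : UnitL2) x = prim (Q g : UnitL2) x := by
  have hx' : s * ((x - t) / s) + t = x := by field_simp; ring
  rw [← hx', prim_copyIn_mul_add, prim_copyOut, Set.indicator_of_mem]
  constructor
  · exact div_pos (by linarith [hx.1]) hs
  · rw [div_lt_one hs]; linarith [hx.2]

/-- Cutting a function that vanishes at `t` and `s + t` down to `(t, s + t)` is an orthogonal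
projection: what is cut off lives on the complement of the interval. -/
theorem inner_copyIn_copyOut {g : energySpace} (hg : Q g = g) :
    inner ℂ (copyIn hs ht hst (copyOut hs Q h0 h1 g))
      (g - copyIn hs ht hst (copyOut hs Q h0 h1 g)) = 0 := by
  set w := copyIn hs ht hst (copyOut hs Q h0 h1 g) with hw
  have hsub : prim ((g - w : energySpace) : UnitL2) = fun x =>
      prim (g : UnitL2) x - prim (w : UnitL2) x := by
    rw [sub_eq_add_neg, ← neg_one_smul ℂ, Submodule.coe_add, prim_add, Submodule.coe_smul,
      prim_smul]
    funext x
    simp [sub_eq_add_neg]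
  have hne : ∀ t : ℝ, ∀ᵐ x, x ≠ t := fun t => compl_mem_ae_iff.2 (measure_singleton t)
  refine inner_eq_zero_of_ae_deriv ?_
  filter_upwards [hne t, hne (s + t)] with x hxt hxst
  by_cases hx : x ∈ Set.Ioo t (s + t)
  · right
    have h : prim ((g - w : energySpace) : UnitL2) =ᶠ[𝓝 x] fun _ => 0 := by
      filter_upwards [isOpen_Ioo.mem_nhds hx] with y hy
      rw [hsub, hw]
      simp only
      rw [prim_copyIn_copyOut hs ht hst Q h0 h1 hy, hg, sub_self]
    rw [h.deriv_eq, deriv_const]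
  · left
    have hx' : x ∉ Set.Icc t (s + t) := fun h =>
      hx ⟨lt_of_le_of_ne h.1 (Ne.symm hxt), lt_of_le_of_ne h.2 hxst⟩
    have h : prim (w : UnitL2) =ᶠ[𝓝 x] fun _ => 0 := by
      filter_upwards [isClosed_Icc.isOpen_compl.mem_nhds hx'] with y hy
      exact prim_copyIn_eq_zero hs ht hst _ fun h => hy (Set.Ioo_subset_Icc_self h)
    rw [h.deriv_eq, deriv_const]

end Copies

/-! ### The similarity decomposition of the string operator -/

section Main

variable {n m : ℕ} {a d β : ℕ → ℝ} {P : ℝ → ℝ}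

theorem reApplyInnerSelf_stringOperator (hP : MemLp P 2 (volume.restrict (Set.Icc (0 : ℝ) 1)))
    (g : energySpace) : (stringOperator (toUnitL2 hP)).reApplyInnerSelf g =
      (pairing P fun t => prim (g : UnitL2) t * conj (prim (g : UnitL2) t)).re := by
  rw [← inner_stringOperator_eq_pairing hP, ContinuousLinearMap.reApplyInnerSelf_apply,
    inner_re_symm]
  rfl

/-- The indices `1, …, n - 1` of the cut points inside `(0, 1)`. -/
abbrev InnerCut (n : ℕ) : Type := {k // k ∈ Finset.Icc 1 (n - 1)}

theorem AdmissibleParams.add_le_of_ne (h : AdmissibleParams n a d) {ε : ℝ}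
    (hε : ∀ k ∈ Finset.Icc 1 n, ε ≤ a k ∧ ε ≤ a m * a k) {j k : ℕ} (hj : j ≤ n) (hk : k ≤ n)
    (hjk : j ≠ k) : ε ≤ |cutPoint a j - cutPoint a k| := by
  have key : ∀ i l, i < l → l ≤ n → ε ≤ cutPoint a l - cutPoint a i := fun i l hil hl => by
    have h1 := h.cutPoint_add_le hil hl
    have h2 := (hε (i + 1) (Finset.mem_Icc.2 ⟨by omega, by omega⟩)).1
    linarith
  rcases lt_or_gt_of_ne hjk with h1 | h1
  · rw [abs_sub_comm]
    exact (key j k h1 hk).trans (le_abs_self _)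
  · exact (key k j h1 hj).trans (le_abs_self _)

theorem AdmissibleParams.memH_tent_cutPoint (h : AdmissibleParams n a d) {ε : ℝ} (hε0 : 0 < ε)
    (hε : ∀ k ∈ Finset.Icc 1 n, ε ≤ a k ∧ ε ≤ a m * a k) (k : InnerCut n) :
    MemH (tent (cutPoint a k) ε) := by
  obtain ⟨k, hk⟩ := k
  obtain ⟨hk1, hk2⟩ := Finset.mem_Icc.1 hk
  refine memH_tent hε0 ?_ ?_
  · have h1 := h.add_le_of_ne hε (j := k) (k := 0) (by omega) (by omega) (by omega)
    rwa [cutPoint_zero, sub_zero, abs_of_nonneg (h.cutPoint_nonneg (by omega))] at h1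
  · have h1 := h.add_le_of_ne hε (j := n) (k := k) le_rfl (by omega) (by omega)
    rw [h.cutPoint_last, abs_of_nonneg (sub_nonneg.2 (h.cutPoint_le_one (by omega)))] at h1
    simp only
    linarith

/-- Subtraction of the combination of tents that has the same values at the cut points. -/
noncomputable def removeTents (a : ℕ → ℝ) (h : InnerCut n → energySpace) :
    energySpace →ₗ[ℂ] energySpace :=
  LinearMap.id - ∑ k : InnerCut n, (evalAt (cutPoint a k)).smulRight (h k)

theorem removeTents_eq_self {h : InnerCut n → energySpace} {g : energySpace}
    (hg : ∀ k : InnerCut n, evalAt (cutPoint a k) g = 0) : removeTents a h g = g := by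
  simp only [removeTents, LinearMap.sub_apply, LinearMap.id_apply, LinearMap.sum_apply,
    LinearMap.smulRight_apply, hg, zero_smul, Finset.sum_const_zero, sub_zero]

theorem evalAt_removeTents (hpar : AdmissibleParams n a d) {h : InnerCut n → energySpace}
    (hh : ∀ k j : InnerCut n, evalAt (cutPoint a k) (h j) = if k = j then 1 else 0)
    {k : ℕ} (hk : k ≤ n) (g : energySpace) : evalAt (cutPoint a k) (removeTents a h g) = 0 := by
  by_cases hk1 : k ∈ Finset.Icc 1 (n - 1)
  · have := hh ⟨k, hk1⟩
    simp only at this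
    simp [removeTents, this]
  · rw [evalAt_apply]
    refine (memH_prim (removeTents a h g).2).zero_off _ ?_
    rw [Finset.mem_Icc] at hk1
    obtain rfl | rfl : k = 0 ∨ k = n := by omega
    · rw [cutPoint_zero]; simp
    · rw [hpar.cutPoint_last]; simp

theorem reApplyInnerSelf_eq_mul_copyOut (hP : IsSelfSimilar n a d β P) (h : AdmissibleParams n a d)
    (hm : m ∈ Finset.Icc 1 n) (hd : ∀ k ∈ Finset.Icc 1 n, k ≠ m → d k = 0)
    {Q : energySpace →ₗ[ℂ] energySpace} (h0 : ∀ g, evalAt (cutPoint a (m - 1)) (Q g) = 0)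
    (h1 : ∀ g, evalAt (a m + cutPoint a (m - 1)) (Q g) = 0) {v : energySpace} (hQ : Q v = v)
    (hv0 : ∀ k ≤ n, prim (v : UnitL2) (cutPoint a k) = 0) :
    (stringOperator (toUnitL2 hP.memLp)).reApplyInnerSelf v =
      d m * (stringOperator (toUnitL2 hP.memLp)).reApplyInnerSelf
        (copyOut (h.pos m hm) Q h0 h1 v) := by
  rw [reApplyInnerSelf_stringOperator, reApplyInnerSelf_stringOperator,
    pairing_eq_mul_pairing_rescale hP h hm hd ((memH_prim v.2).mul_conj (memH_prim v.2))
      (fun k hk => by rw [hv0 k hk, zero_mul]), Complex.re_ofReal_mul, prim_copyOut, hQ]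
  congr 3
  funext x
  by_cases hx : x ∈ Set.Ioo (0 : ℝ) 1
  · simp only [Set.indicator_of_mem hx]
  · simp only [Set.indicator_of_notMem hx, zero_mul]

/-- The tents are narrower than the pieces and their copies in the `m`-th piece, so that next to a
cut point `P` has on their support the constant values `leftValue` and `rightValue`. -/
theorem exists_similarityDecomposition (hP : IsSelfSimilar n a d β P) (h : AdmissibleParams n a d)
    (hm : m ∈ Finset.Icc 1 n) (hd : ∀ k ∈ Finset.Icc 1 n, k ≠ m → d k = 0) :
    Nonempty (SimilarityDecomposition (stringOperator (toUnitL2 hP.memLp))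
      (fun k : InnerCut n => zeta n m d β k) (a m) (d m)) := by
  obtain ⟨ε, hε0, hε⟩ := h.exists_small hm
  obtain ⟨hm1, hmn⟩ := Finset.mem_Icc.1 hm
  have ham := h.pos m hm
  have ht := h.cutPoint_nonneg (k := m - 1) (by omega)
  have hcut : a m + cutPoint a (m - 1) = cutPoint a m := by rw [cutPoint_eq_add hm1, add_comm]
  have hst : a m + cutPoint a (m - 1) ≤ 1 := by rw [hcut]; exact h.cutPoint_le_one hmn
  have hle : ∀ k : InnerCut n, (k : ℕ) ≤ n := fun k => by
    have := (Finset.mem_Icc.1 k.2).2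
    omega
  let H : InnerCut n → energySpace := fun k => ofMemH (h.memH_tent_cutPoint hε0 hε k)
  have hH : ∀ k : InnerCut n, prim (H k : UnitL2) = tent (cutPoint a k) ε := fun k => prim_ofMemH _
  have hevH : ∀ k j : InnerCut n, evalAt (cutPoint a k) (H j) = if k = j then 1 else 0 := by
    intro k j
    rw [evalAt_apply, hH]
    split_ifs with hkj
    · rw [hkj, tent_self]
    · exact tent_eq_zero hε0 (h.add_le_of_ne hε (hle k) (hle j) fun h' => hkj (Subtype.ext h'))
  let J := copyIn ham ht hst
  have hevJ : ∀ (k : InnerCut n) u, evalAt (cutPoint a k) (J u) = 0 := fun k u => by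
    refine prim_copyIn_eq_zero ham ht hst u fun hk => ?_
    rw [hcut] at hk
    rcases lt_or_ge (k : ℕ) m with h1 | h1
    · have := h.cutPoint_mono (j := k) (k := m - 1) (by omega) (by omega)
      linarith [hk.1]
    · have := h.cutPoint_mono h1 (hle k)
      linarith [hk.2]
  let Q := removeTents a H
  have h0 : ∀ g, evalAt (cutPoint a (m - 1)) (Q g) = 0 :=
    fun g => evalAt_removeTents h hevH (by omega) g
  have h1 : ∀ g, evalAt (a m + cutPoint a (m - 1)) (Q g) = 0 :=
    fun g => by rw [hcut]; exact evalAt_removeTents h hevH hmn g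
  have hQ : ∀ {g}, (∀ k : InnerCut n, evalAt (cutPoint a k) g = 0) → Q g = g := fun hg =>
    removeTents_eq_self hg
  have hform : ∀ v, (∀ k : InnerCut n, evalAt (cutPoint a k) v = 0) →
      (stringOperator (toUnitL2 hP.memLp)).reApplyInnerSelf v =
        d m * (stringOperator (toUnitL2 hP.memLp)).reApplyInnerSelf (copyOut ham Q h0 h1 v) :=
    fun v hv => reApplyInnerSelf_eq_mul_copyOut hP h hm hd h0 h1 (hQ hv) fun k hk => by
      rw [← hQ hv]
      exact evalAt_removeTents h hevH hk v
  refine ⟨{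
    J := J
    R := copyOut ham Q h0 h1
    h := H
    ev := fun k => evalAt (cutPoint a k)
    norm_J := norm_sq_copyIn ham ht hst
    ev_J := hevJ
    ev_h := hevH
    inner_h := fun k y => ?_
    form_J := fun u => ?_
    form_of_ev_eq_zero := hform
    inner_J_R := fun v hv => inner_copyIn_copyOut ham ht hst Q _ _ (hQ hv) }⟩
  · have hkn := hle k
    rw [inner_stringOperator_eq_pairing, hH, pairing_eq_jump hP.memLp
      ((memH_prim y.2).mul_conj (h.memH_tent_cutPoint hε0 hε k))
      ⟨h.cutPoint_nonneg hkn, h.cutPoint_le_one hkn⟩ (fun x hx => ?_)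
      (hP.ae_eq_leftValue h hm hd hε k.2) (hP.ae_eq_rightValue h hm hd hε k.2),
      rightValue_sub_leftValue, tent_self, map_one, mul_one]
    · rfl
    · rw [tent_eq_zero hε0, map_zero, mul_zero]
      by_contra hlt
      rw [not_le, abs_lt] at hlt
      exact hx ⟨by linarith [hlt.1], by linarith [hlt.2]⟩
  · rw [hform (J u) fun k => hevJ k u]
    congr 2
    exact copyOut_copyIn ham ht hst Q _ _ (hQ fun k => hevJ k u)

end Main

end SelfSimilarString

theorem mainTheorem1 (n m : ℕ) (a d β : ℕ → ℝ)
    (hpar : SelfSimilarString.AdmissibleParams n a d)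
    (hm : m ∈ Finset.Icc 1 n)
    (hd : ∀ k ∈ Finset.Icc 1 n, k ≠ m → d k = 0)
    (P : ℝ → ℝ) (hP : SelfSimilarString.IsSelfSimilar n a d β P)
    (hdm : 0 < d m)
    (hZpos : 0 < SelfSimilarString.Zplus n m d β)
    (hZ : SelfSimilarString.Zplus n m d β + SelfSimilarString.Zminus n m d β = n - 1) :
    ∃ lam : ℕ → ℝ,
      -- `lam 1 < lam 2 < …` are all the positive eigenvalues, each of them simple
      StrictMonoOn lam (Set.Ici 1) ∧
      lam '' Set.Ici 1 = {x : ℝ | 0 < x ∧ SelfSimilarString.IsEigenvalue P x} ∧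
      (∀ k, 1 ≤ k → SelfSimilarString.IsSimpleEigenvalue P (lam k)) ∧
      ∃ μ : ℕ → ℝ,
        ∀ l ∈ Finset.Icc 1 (SelfSimilarString.Zplus n m d β),
          0 < μ l ∧
          (fun k : ℕ => lam (l + k * SelfSimilarString.Zplus n m d β))
            ~[atTop] (fun k : ℕ => μ l * (a m * d m) ^ (-(k : ℤ))) := by
  obtain ⟨D⟩ := SelfSimilarString.exists_similarityDecomposition hP hpar hm hd
  have hne : ∀ k : SelfSimilarString.InnerCut n, SelfSimilarString.zeta n m d β k ≠ 0 := by
    intro k hk0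
    -- a vanishing `ζ_k` is counted neither by `Z₊` nor by `Z₋`
    have hle : SelfSimilarString.Zplus n m d β + SelfSimilarString.Zminus n m d β ≤
        ((Finset.Icc 1 (n - 1)).erase k).card := by
      rw [SelfSimilarString.Zplus, SelfSimilarString.Zminus, ← Finset.card_union_of_disjoint]
      · refine Finset.card_le_card fun j hj => ?_
        rw [Finset.mem_union, Finset.mem_filter, Finset.mem_filter] at hj
        refine Finset.mem_erase.2 ⟨fun hjk => ?_, hj.elim And.left And.left⟩
        rw [hjk, hk0, neg_zero] at hj
        exact hj.elim (fun h => lt_irrefl _ h.2) (fun h => lt_irrefl _ h.2)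
      · refine Finset.disjoint_filter.2 fun j _ h1 h2 => ?_
        linarith
    rw [hZ, Finset.card_erase_of_mem k.2, Nat.card_Icc] at hle
    have := Finset.mem_Icc.1 k.2
    omega
  have hcard : Fintype.card {k : SelfSimilarString.InnerCut n //
      0 < SelfSimilarString.zeta n m d β k} = SelfSimilarString.Zplus n m d β := by
    rw [SelfSimilarString.Zplus, ← Fintype.card_coe]
    exact Fintype.card_congr ((Equiv.subtypeSubtypeEquivSubtypeInter
      (fun k => k ∈ Finset.Icc 1 (n - 1)) (fun k => 0 < SelfSimilarString.zeta n m d β k)).trans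
      (Equiv.subtypeEquivRight fun k => by rw [Finset.mem_filter]))
  obtain ⟨lam, hmono, himage, hμ⟩ := D.exists_enumeration_charValues
    (SelfSimilarString.isCompactOperator_stringOperator _)
    (SelfSimilarString.isSymmetric_stringOperator _)
    (SelfSimilarString.hasSimpleCharValues_stringOperator hP.memLp) (hpar.pos m hm) hdm
    (hpar.mul_lt_one hm hdm) hne hcard hZpos
  refine ⟨lam, hmono, himage.trans (SelfSimilarString.setOf_isEigenvalue_eq hP.memLp).symm,
    fun k hk => ?_, hμ⟩
  exact SelfSimilarString.isSimpleEigenvalue_of_mem_charValues hP.memLp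
    (himage ▸ Set.mem_image_of_mem lam hk)
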